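/- Let $p$ be a prime and $n$ a natural number. For $0 \le k \le n-1$ let $\sigma_k$ be the permutation of $\mathbb{F}_p^n$ which sends $(\lambda_0,\ldots,\lambda_{n-1})$ to $(\lambda_0,\ldots,\lambda_k+1,\ldots,\lambda_{n-1})$ if $\lambda_l = 0$ for all $l<k$, and fixes all other points. For $0 \le m \le n$ put $P_m = \langle \sigma_0,\ldots,\sigma_{m-1}\rangle \le \operatorname{Sym}(\mathbb{F}_p^n)$; so $P_m$ is the $m$-fold iterated wreath product $C_p \wr \cdots \wr C_p$, and $P_n$ is a Sylow $p$-subgroup of $\operatorname{Sym}(\mathbb{F}_p^n)$. Let $r$ be a generator of $\mathbb{F}_p^\times$, let $\eta_k \in \operatorname{Sym}(\mathbb{F}_p^n)$ multiply the $k$-th coordinate by $r$ and fix the other coordinates, and let $H = \langle \eta_0,\ldots,\eta_{n-1}\rangle$, which normalizes $P_n$. For $0 \le m \le n$ let $T_m$ be the base group of $P_n = P_{n-m} \wr P_m$, that is, the group of all elements of $P_n$ which do not change the first $m$ coordinates of any point. The depth of a subgroup $S \le P_n$ is the largest $m \in \{0,\ldots,n\}$ with $S \le T_m$. For $0 \le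 k \le n-1$ let $A^k = A^k_0$ be the base group of $P_{k+1} = C_p \wr P_k$, that is, the group of all permutations $(\lambda_0,\ldots,\lambda_{n-1}) \mapsto (\lambda_0,\ldots,\lambda_{k-1},\lambda_k + f(\lambda_0,\ldots,\lambda_{k-1}),\lambda_{k+1},\ldots,\lambda_{n-1})$ with $f \colon \mathbb{F}_p^k \to \mathbb{F}_p$, and define $A^k_{i+1} = [P_{k+1},A^k_i]$ for $i \ge 0$. Let $0 \le j \le n-1$, let $i_j,\ldots,i_{n-1} \ge 0$ be integers, and suppose that $N = A^j_{i_j}A^{j+1}_{i_{j+1}}\cdots A^{n-1}_{i_{n-1}}$ is a normal subgroup of $P_n$ of depth $j$. Then the following three statements are equivalent: 1. $N$ has a complement in $P_n$, i.e. there is a subgroup $C \le P_n$ with $NC = P_n$ and $N \cap C = 1$. 2. $N$ has a complement in $P_n$ which is invariant under conjugation by $H$. 3. $i_j = 0$, and $i_k \in \{0,p^j\}$ for all $j \le k \le n-1$. -/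

import Mathlib

open scoped Pointwise

namespace PartitionSubgroups

/-- `𝔽_p^n`; its symmetric group is identified with the symmetric group on `p^n` points. -/
abbrev Pts (p n : ℕ) : Type := Fin n → ZMod p

/-- The permutation `σ_k` of `𝔽_p^n`: it adds `1` to the coordinate `k` if all earlier
coordinates vanish, and it fixes all other points. -/
def sigma (p n : ℕ) (k : Fin n) : Equiv.Perm (Pts p n) where
  toFun x := if ∀ l < k, x l = 0 then Function.update x k (x k + 1) else x
  invFun x := if ∀ l < k, x l = 0 then Function.update x k (x k - 1) else x
  left_inv x := by
    by_cases h : ∀ l < k, x l = 0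
    · have h' : ∀ l < k, Function.update x k (x k + 1) l = 0 := fun l hl => by
        rw [Function.update_of_ne hl.ne]; exact h l hl
      simp only [if_pos h, if_pos h']
      simp
    · simp only [if_neg h]
  right_inv x := by
    by_cases h : ∀ l < k, x l = 0
    · have h' : ∀ l < k, Function.update x k (x k - 1) l = 0 := fun l hl => by
        rw [Function.update_of_ne hl.ne]; exact h l hl
      simp only [if_pos h, if_pos h']
      simp
    · simp only [if_neg h]

/-- The subgroup `⟨σ_0, …, σ_{m-1}⟩` of `Sym(𝔽_p^n)`, for `m ≤ n`. It is the iterated wreath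
product `P_m = C_p ≀ ⋯ ≀ C_p` (`m` factors), acting on the first `m` coordinates. -/
def wreathP (p n m : ℕ) : Subgroup (Equiv.Perm (Pts p n)) :=
  Subgroup.closure {g | ∃ k : Fin n, (k : ℕ) < m ∧ g = sigma p n k}

/-- `P_n`, the Sylow `p`-subgroup `⟨σ_0, …, σ_{n-1}⟩` of `Sym(𝔽_p^n)`. -/
abbrev sylowP (p n : ℕ) : Subgroup (Equiv.Perm (Pts p n)) := wreathP p n n

/-- The first `k` coordinates of a point. -/
def firstCoords {p n : ℕ} (k : Fin n) (x : Pts p n) : Pts p k :=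
  fun l => x (Fin.castLE k.isLt.le l)

theorem firstCoords_update {p n : ℕ} (k : Fin n) (x : Pts p n) (a : ZMod p) :
    firstCoords k (Function.update x k a) = firstCoords k x := by
  funext l
  have h : Fin.castLE k.isLt.le l ≠ k := fun h =>
    l.isLt.ne (congrArg Fin.val h)
  simp [firstCoords, Function.update_of_ne h]

/-- `A^k`, the base group of `P_{k+1} = C_p ≀ P_k`: families `f` of elements of
`C_p = (𝔽_p, +)` indexed by `𝔽_p^k`, acting by
`x ↦ (x_0, …, x_{k-1}, x_k + f (x_0, …, x_{k-1}), x_{k+1}, …)`. -/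
def baseA (p n : ℕ) (k : Fin n) : Subgroup (Equiv.Perm (Pts p n)) where
  carrier := {g | ∃ f : Pts p k → ZMod p,
    ∀ x, g x = Function.update x k (x k + f (firstCoords k x))}
  one_mem' := ⟨0, fun x => by simp⟩
  mul_mem' := by
    rintro g h ⟨f, hf⟩ ⟨f', hf'⟩
    refine ⟨f' + f, fun x => ?_⟩
    rw [Equiv.Perm.mul_apply, hf', hf, firstCoords_update]
    simp [add_assoc]
  inv_mem' := by
    rintro g ⟨f, hf⟩
    refine ⟨-f, fun x => ?_⟩
    rw [Equiv.Perm.inv_eq_iff_eq, hf, firstCoords_update]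
    simp

/-- Weir's subgroups `A^k_i`: `A^k_0 = A^k` and `A^k_{i+1} = [P_{k+1}, A^k_i]`. -/
def weirA (p n : ℕ) (k : Fin n) : ℕ → Subgroup (Equiv.Perm (Pts p n))
  | 0 => baseA p n k
  | i + 1 => ⁅wreathP p n (k + 1), weirA p n k i⁆

/-- `T_m`, the base group of `P_n = P_{n-m} ≀ P_m`, i.e. the elements of `P_n` which do not
change the first `m` coordinates of any point. -/
def weirT (p n m : ℕ) : Subgroup (Equiv.Perm (Pts p n)) where
  carrier := {g | g ∈ sylowP p n ∧ ∀ x, ∀ l : Fin n, (l : ℕ) < m → g x l = x l}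
  one_mem' := ⟨one_mem _, fun _ _ _ => rfl⟩
  mul_mem' := by
    rintro g h ⟨hg, hg'⟩ ⟨hh, hh'⟩
    refine ⟨mul_mem hg hh, fun x l hl => ?_⟩
    rw [Equiv.Perm.mul_apply, hg' _ l hl, hh' x l hl]
  inv_mem' := by
    rintro g ⟨hg, hg'⟩
    refine ⟨inv_mem hg, fun x l hl => ?_⟩
    have h := hg' (g⁻¹ x) l hl
    have e : g (g⁻¹ x) = x := Equiv.apply_symm_apply g x
    rw [e] at h
    exact h.symm

/-- The depth of a subgroup `S` of `P_n` is the largest `m ∈ {0, …, n}` with `S ≤ T_m`. -/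
def HasDepth (p n : ℕ) (S : Subgroup (Equiv.Perm (Pts p n))) (j : ℕ) : Prop :=
  IsGreatest {m | m ≤ n ∧ S ≤ weirT p n m} j

/-- The set of products `A^j_{i_j} A^{j+1}_{i_{j+1}} ⋯ A^{n-1}_{i_{n-1}}`, in this order. -/
def partitionProduct (p n : ℕ) (j : Fin n) (i : Fin n → ℕ) : Set (Equiv.Perm (Pts p n)) :=
  (((List.finRange n).filter (fun k => j ≤ k)).map
    (fun k => (weirA p n k (i k) : Set (Equiv.Perm (Pts p n))))).prod

/-- The permutation `η_k` of `𝔽_p^n`: it multiplies the coordinate `k` by `r`. -/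
def eta (p n : ℕ) (r : (ZMod p)ˣ) (k : Fin n) : Equiv.Perm (Pts p n) where
  toFun x := Function.update x k ((r : ZMod p) * x k)
  invFun x := Function.update x k (((r⁻¹ : (ZMod p)ˣ) : ZMod p) * x k)
  left_inv x := by simp
  right_inv x := by simp

/-- `H = ⟨η_0, …, η_{n-1}⟩`. -/
def hallH (p n : ℕ) (r : (ZMod p)ˣ) : Subgroup (Equiv.Perm (Pts p n)) :=
  Subgroup.closure (Set.range (eta p n r))

/-- `C` is a complement in `P` of the subgroup `N` of `P`. -/
def IsComplementIn {G : Type*} [Group G] (P N C : Subgroup G) : Prop :=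
  C ≤ P ∧ N ⊓ C = ⊥ ∧ (N : Set G) * (C : Set G) = (P : Set G)

/-- `C` is invariant under conjugation by the elements of `H`. -/
def IsConjInvariant {G : Type*} [Group G] (H C : Subgroup G) : Prop :=
  ∀ h ∈ H, C.map (MulAut.conj h).toMonoidHom = C

end PartitionSubgroups

open scoped commutatorElement

namespace PartitionSubgroups

/-! $P_n$ consists of the triangular permutations: `g` shifts coordinate `k` by a function `disp g
k` of the earlier coordinates, and $A^k_i$ corresponds to the term `lowerFn p n k i` of the lower
series of the functions on $\mathbb{F}_p^k$ (`mem_weirA_iff`). So $N$ amounts to one space of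
functions for each $k \ge j$. The main tool is `fiberSum j k`, summation over the coordinates
$j,\ldots,k-1$. It is equivariant, its kernel on `lowFn p n k` is exactly the $p^j$-th term of the
series (`mem_lowerFn_pow_iff`), and on $T_j$ the fibre sum of the displacement is a homomorphism
(`fiberSum_disp_mul`).

Necessity: normality and depth $j$ put every function with zero fibre sum into the space of $N$ at
$k$, so $N$ is determined inside $T_j$ by fibre sums. The elements of $C \cap T_j$ that look like
elements of $N$ at every coordinate except $k$ yield a second invariant space (`complementFn`),
which meets the fibre sums of $N$ at $k$ trivially. A nonzero invariant space contains the constant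
`1` (`one_mem_of_invariant`), so one of the two vanishes. If that of $C$ vanishes, then $N$ contains
$A^k$ and $i_k = 0$. If that of $N$ vanishes, its space at $k$ is the kernel of the fibre sum, which
gives $i_k = p^j$ for $k > j$ because nonzero terms of the series are distinct, and contradicts the
depth for $k = j$.

Sufficiency: `lead j k` has fibre sum `-1`, so its multiples by functions of the first $j$
coordinates complement the kernel of the fibre sum. Shifts by such multiples do not change `lead`,
hence form a group, `leadGroup`. Rescaling coordinates preserves which of them vanish, hence `lead`,
so $H$ normalizes this group. -/

/-! ### Triangular permutations and their displacements -/

/-- Two points agree on their first `m` coordinates. -/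
def Agree {p n : ℕ} (m : ℕ) (x y : Pts p n) : Prop := ∀ l : Fin n, (l : ℕ) < m → x l = y l

theorem Agree.symm {p n m : ℕ} {x y : Pts p n} (h : Agree m x y) : Agree m y x :=
  fun l hl => (h l hl).symm

theorem Agree.trans {p n m : ℕ} {x y z : Pts p n} (h : Agree m x y) (h' : Agree m y z) :
    Agree m x z := fun l hl => (h l hl).trans (h' l hl)

theorem Agree.mono {p n m m' : ℕ} {x y : Pts p n} (h : Agree m x y) (hm : m' ≤ m) :
    Agree m' x y := fun l hl => h l (hl.trans_le hm)

theorem Agree.refl {p n : ℕ} (m : ℕ) (x : Pts p n) : Agree m x x := fun _ _ => rfl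

theorem Agree.eq {p n m : ℕ} {x y : Pts p n} (h : Agree m x y) (hm : n ≤ m) : x = y :=
  funext fun l => h l (l.isLt.trans_le hm)

/-- The functions on `𝔽_p^n` that depend only on the first `m` coordinates. -/
def lowFn (p n m : ℕ) : Submodule (ZMod p) (Pts p n → ZMod p) where
  carrier := {v | ∀ x y, Agree m x y → v x = v y}
  add_mem' := fun ha hb x y h => by simp [ha x y h, hb x y h]
  zero_mem' := fun _ _ _ => rfl
  smul_mem' := fun c v hv x y h => by simp [hv x y h]

/-- The displacement of the coordinate `k` under `g`. -/
def disp {p n : ℕ} (g : Equiv.Perm (Pts p n)) (k : Fin n) (x : Pts p n) : ZMod p := g x k - x k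

theorem apply_eq_add_disp {p n : ℕ} (g : Equiv.Perm (Pts p n)) (k : Fin n) (x : Pts p n) :
    g x k = x k + disp g k x := by simp [disp]

theorem apply_eq_of_disp_eq_zero {p n : ℕ} {g : Equiv.Perm (Pts p n)} {k : Fin n}
    (h : disp g k = 0) (x : Pts p n) : g x k = x k := by
  rw [apply_eq_add_disp, h]; simp

theorem disp_mul {p n : ℕ} (g h : Equiv.Perm (Pts p n)) (k : Fin n) (x : Pts p n) :
    disp (g * h) k x = disp g k (h x) + disp h k x := by
  simp [disp, Equiv.Perm.mul_apply]

@[simp] theorem disp_one {p n : ℕ} (k : Fin n) : disp (1 : Equiv.Perm (Pts p n)) k = 0 := by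
  funext x; simp [disp]

theorem disp_inv {p n : ℕ} (g : Equiv.Perm (Pts p n)) (k : Fin n) (x : Pts p n) :
    disp g⁻¹ k x = - disp g k (g⁻¹ x) := by
  simp [disp]

theorem disp_conj {p n : ℕ} (q g : Equiv.Perm (Pts p n)) (k : Fin n) (x : Pts p n) :
    disp (q * g * q⁻¹) k x =
      disp q k (g (q⁻¹ x)) - disp q k (q⁻¹ x) + disp g k (q⁻¹ x) := by
  rw [disp_mul, disp_mul, disp_inv]; ring

theorem ext_disp {p n : ℕ} {g h : Equiv.Perm (Pts p n)} (H : ∀ k : Fin n, disp g k = disp h k) :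
    g = h := by
  ext x k
  rw [apply_eq_add_disp, apply_eq_add_disp, H]

theorem agree_apply_self {p n m : ℕ} {g : Equiv.Perm (Pts p n)}
    (h : ∀ k : Fin n, (k : ℕ) < m → disp g k = 0) (x : Pts p n) : Agree m (g x) x :=
  fun l hl => apply_eq_of_disp_eq_zero (h l hl) x

/-- The shift of a coordinate depends on earlier ones only, so the coordinates of the source can be
recovered one after another. -/
theorem agree_add_iff {p n m : ℕ} {d : Fin n → Pts p n → ZMod p}
    (hd : ∀ k : Fin n, d k ∈ lowFn p n k) (x y : Pts p n) :
    Agree m (fun l => x l + d l x) (fun l => y l + d l y) ↔ Agree m x y := by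
  constructor
  · intro h
    have key : ∀ t, ∀ l : Fin n, (l : ℕ) = t → (l : ℕ) < m → x l = y l := by
      intro t
      induction t using Nat.strong_induction_on with
      | _ t ih =>
        intro l hl hm
        have h1 := h l hm
        have h2 : d l x = d l y := hd l x y fun l' hl' => ih l' (hl ▸ hl') l' rfl (hl'.trans hm)
        simp only [h2] at h1
        exact add_right_cancel h1
    exact fun l hl => key l l rfl hl
  · intro h l hl
    have h2 : d l x = d l y := hd l x y (h.mono hl.le)
    simp only [h2, h l hl]

/-- The triangular permutations: each coordinate is shifted by a function of the earlier ones. -/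
def tri (p n : ℕ) : Subgroup (Equiv.Perm (Pts p n)) where
  carrier := {g | ∀ k : Fin n, disp g k ∈ lowFn p n k}
  one_mem' := fun k => by simp
  mul_mem' := by
    intro g h hg hh k x y hxy
    have e : ∀ z, h z = fun l => z l + disp h l z := fun z => funext fun l =>
      apply_eq_add_disp h l z
    rw [disp_mul, disp_mul, hh k x y hxy, hg k (h x) (h y)]
    rw [e x, e y]
    exact (agree_add_iff hh x y).2 hxy
  inv_mem' := by
    intro g hg k x y hxy
    have e : ∀ z, g z = fun l => z l + disp g l z := fun z => funext fun l =>
      apply_eq_add_disp g l z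
    rw [disp_inv, disp_inv, hg k (g⁻¹ x) (g⁻¹ y)]
    rw [← agree_add_iff hg, ← e, ← e]
    simpa using hxy

theorem agree_apply_iff {p n m : ℕ} {g : Equiv.Perm (Pts p n)} (hg : g ∈ tri p n)
    {x y : Pts p n} : Agree m (g x) (g y) ↔ Agree m x y := by
  have e : ∀ z, g z = fun l => z l + disp g l z := fun z => funext fun l =>
      apply_eq_add_disp g l z
  rw [e x, e y]
  exact agree_add_iff hg x y

theorem comp_mem_lowFn {p n m : ℕ} {v : Pts p n → ZMod p} (hv : v ∈ lowFn p n m)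
    {g : Equiv.Perm (Pts p n)} (hg : g ∈ tri p n) : v ∘ g ∈ lowFn p n m :=
  fun _ _ h => hv _ _ ((agree_apply_iff hg).2 h)

/-- Displacements in `lowFn` can be prescribed freely. -/
theorem exists_disp {p n : ℕ} [NeZero p] (d : Fin n → Pts p n → ZMod p)
    (hd : ∀ k : Fin n, d k ∈ lowFn p n k) : ∃ g ∈ tri p n, ∀ k : Fin n, disp g k = d k := by
  have hinj : Function.Injective (fun x : Pts p n => fun l => x l + d l x) := fun x y h =>
    Agree.eq (m := n) ((agree_add_iff hd x y).1 (by simp only at h; rw [h]; exact Agree.refl _ _))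
      le_rfl
  let g : Equiv.Perm (Pts p n) := Equiv.ofBijective _ (Finite.injective_iff_bijective.1 hinj)
  have hg : ∀ k : Fin n, disp g k = d k := fun k => by
    funext x
    simp [disp, g]
  exact ⟨g, fun k => hg k ▸ hd k, hg⟩

/-- A shift of the coordinate `k` alone. -/
theorem exists_pure {p n : ℕ} [NeZero p] {k : Fin n} {v : Pts p n → ZMod p}
    (hv : v ∈ lowFn p n k) :
    ∃ g ∈ tri p n, disp g k = v ∧ ∀ l : Fin n, l ≠ k → disp g l = 0 := by
  obtain ⟨g, hg, h⟩ := exists_disp (Pi.single k v) (fun l => by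
    by_cases hl : l = k
    · subst hl; simpa using hv
    · simp [hl])
  exact ⟨g, hg, by simp [h], fun l hl => by simp [h, hl]⟩

/-- The truncation of a triangular permutation to the first `m` coordinates. -/
theorem exists_trunc {p n : ℕ} [NeZero p] (m : ℕ) {g : Equiv.Perm (Pts p n)}
    (hg : g ∈ tri p n) :
    ∃ h ∈ tri p n, (∀ k : Fin n, (k : ℕ) < m → disp h k = disp g k) ∧
      ∀ k : Fin n, m ≤ k → disp h k = 0 := by
  obtain ⟨h, hh, e⟩ := exists_disp (fun k : Fin n => if (k : ℕ) < m then disp g k else 0)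
    (fun k => by split_ifs <;> [exact hg k; exact zero_mem _])
  exact ⟨h, hh, fun k hk => by simp [e, hk], fun k hk => by simp [e, not_lt.2 hk]⟩

theorem agree_trunc {p n m : ℕ} {g h : Equiv.Perm (Pts p n)}
    (e : ∀ k : Fin n, (k : ℕ) < m → disp h k = disp g k) (x : Pts p n) :
    Agree m (h x) (g x) := fun l hl => by
  rw [apply_eq_add_disp, apply_eq_add_disp, e l hl]

/-- Conjugates of a shift of the coordinate `k`. -/
theorem disp_conj_pure {p n : ℕ} {q g : Equiv.Perm (Pts p n)} {k : Fin n}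
    (hq : q ∈ tri p n) (hq' : ∀ l : Fin n, k < l → disp q l = 0) (hg : ∀ l : Fin n, l ≠ k → disp g l = 0) :
    disp (q * g * q⁻¹) k = disp g k ∘ ⇑q⁻¹ ∧ ∀ l : Fin n, l ≠ k → disp (q * g * q⁻¹) l = 0 := by
  have ha : ∀ x, Agree k (g x) x := agree_apply_self fun l hl => hg l (Fin.ne_of_lt hl)
  constructor
  · funext x
    rw [disp_conj, hq k _ _ (ha _)]
    simp
  · intro l hl
    funext x
    rw [disp_conj, hg l hl]
    rcases lt_or_gt_of_ne hl with h | h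
    · rw [hq l _ _ ((ha _).mono (le_of_lt h))]
      simp
    · simp [hq' l h]

/-- The point obtained by putting the coordinates from `m` on to `0`. -/
def res {p n : ℕ} (m : ℕ) (x : Pts p n) : Pts p n := fun l => if (l : ℕ) < m then x l else 0

theorem agree_res {p n : ℕ} (m : ℕ) (x : Pts p n) : Agree m (res m x) x := fun l hl => by
  simp [res, hl]

theorem res_eq_res_iff {p n m : ℕ} {x y : Pts p n} : res m x = res m y ↔ Agree m x y := by
  constructor
  · intro h l hl
    have := congrFun h l
    simpa [res, hl] using this
  · intro h
    funext l
    by_cases hl : (l : ℕ) < m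
    · simp [res, hl, h l hl]
    · simp [res, hl]

theorem res_eq_self_iff {p n m : ℕ} {x : Pts p n} :
    res m x = x ↔ ∀ l : Fin n, m ≤ l → x l = 0 := by
  constructor
  · intro h l hl
    rw [← h]; simp [res, not_lt.2 hl]
  · intro h
    funext l
    by_cases hl : (l : ℕ) < m
    · simp [res, hl]
    · simp [res, hl, h l (not_lt.1 hl)]

theorem res_res_of_le {p n m m' : ℕ} (h : m ≤ m') (x : Pts p n) : res m' (res m x) = res m x :=
  res_eq_self_iff.2 fun l hl => by simp [res, not_lt.2 (h.trans hl)]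

open Classical in
/-- The indicator function of the points agreeing with `c` on the first `m` coordinates. -/
noncomputable def ind {p n : ℕ} (m : ℕ) (c : Pts p n) : Pts p n → ZMod p :=
  fun x => if Agree m x c then 1 else 0

theorem ind_mem {p n : ℕ} (m : ℕ) (c : Pts p n) : ind m c ∈ lowFn p n m := fun x y h => by
  have : Agree m x c ↔ Agree m y c := ⟨fun h' => h.symm.trans h', fun h' => h.trans h'⟩
  by_cases h' : Agree m y c
  · simp [ind, h', this.2 h']
  · simp [ind, h', mt this.1 h']

theorem ind_comp {p n m : ℕ} {g : Equiv.Perm (Pts p n)} (hg : g ∈ tri p n) (c : Pts p n) :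
    ind m (g c) ∘ g = ind m c := by
  funext x
  by_cases h : Agree m x c
  · simp [ind, h, (agree_apply_iff hg).2 h]
  · simp [ind, h, mt (agree_apply_iff hg).1 h]

-- The points with `res m c = c` represent each choice of the first `m` coordinates once.
open Classical in
theorem eq_sum_ind {p n m : ℕ} [NeZero p] {v : Pts p n → ZMod p} (hv : v ∈ lowFn p n m) :
    v = ∑ c : Pts p n, if res m c = c then v c • ind m c else 0 := by
  funext x
  rw [Finset.sum_apply, Finset.sum_eq_single (res m x)]
  · have h1 : ind m (res m x) x = 1 := if_pos (agree_res m x).symm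
    rw [if_pos (res_res_of_le le_rfl x), Pi.smul_apply, h1, hv _ _ (agree_res m x), smul_eq_mul,
      mul_one]
  · intro c _ hcx
    by_cases hc : res m c = c
    · have : ¬ Agree m x c := fun h => hcx (by rw [res_eq_res_iff.2 h]; exact hc.symm)
      rw [if_pos hc, Pi.smul_apply, ind, if_neg this, smul_zero]
    · rw [if_neg hc]; rfl
  · intro h
    exact absurd (Finset.mem_univ _) h

/-! ### Single-coordinate shifts and generation by the `sigma p n k` -/

theorem disp_pow_pure {p n : ℕ} {g : Equiv.Perm (Pts p n)} {k : Fin n} (hg : g ∈ tri p n)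
    (h : ∀ l : Fin n, l < k → disp g l = 0) (t : ℕ) :
    (∀ l : Fin n, l < k → disp (g ^ t) l = 0) ∧ disp (g ^ t) k = t • disp g k := by
  induction t with
  | zero => simp
  | succ t ih =>
    have ha : ∀ x, Agree k ((g ^ t) x) x := agree_apply_self ih.1
    constructor
    · intro l hl
      funext x
      rw [pow_succ', disp_mul, h l hl, ih.1 l hl]; simp
    · funext x
      rw [pow_succ', disp_mul, hg k _ _ (ha x), ih.2, succ_nsmul']; rfl

theorem disp_pow_eq_zero {p n : ℕ} {g : Equiv.Perm (Pts p n)} {l : Fin n} (h : disp g l = 0)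
    (t : ℕ) : disp (g ^ t) l = 0 := by
  induction t with
  | zero => simp
  | succ t ih =>
    funext x
    rw [pow_succ', disp_mul, h, ih]; simp

theorem disp_sigma {p n : ℕ} (k : Fin n) :
    disp (sigma p n k) k = ind k 0 ∧ ∀ l : Fin n, l ≠ k → disp (sigma p n k) l = 0 := by
  constructor
  · funext x
    by_cases h : ∀ l : Fin n, l < k → x l = 0
    · have h' : Agree k x 0 := fun l hl => h l hl
      simp [disp, sigma, ind, h', if_pos h]
    · have h' : ¬ Agree k x 0 := fun h' => h fun l hl => h' l hl
      simp [disp, sigma, ind, h', if_neg h]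
  · intro l hl
    funext x
    by_cases h : ∀ l : Fin n, l < k → x l = 0
    · simp [disp, sigma, if_pos h, hl]
    · simp [disp, sigma, if_neg h]

theorem mem_tri_of_pure {p n : ℕ} {g : Equiv.Perm (Pts p n)} {k : Fin n}
    (h : disp g k ∈ lowFn p n k) (h' : ∀ l : Fin n, l ≠ k → disp g l = 0) : g ∈ tri p n := by
  intro l
  by_cases hl : l = k
  · subst hl; exact h
  · rw [h' l hl]; exact zero_mem _

theorem disp_mul_pure {p n : ℕ} {g h : Equiv.Perm (Pts p n)} {k : Fin n} (hg : g ∈ tri p n)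
    (hg' : ∀ l : Fin n, l ≠ k → disp g l = 0) (hh' : ∀ l : Fin n, l ≠ k → disp h l = 0) :
    disp (g * h) k = disp g k + disp h k ∧ ∀ l : Fin n, l ≠ k → disp (g * h) l = 0 := by
  constructor
  · funext x
    rw [disp_mul, hg k _ _ (agree_apply_self (fun l hl => hh' l (Fin.ne_of_lt hl)) x)]; rfl
  · intro l hl
    funext x
    rw [disp_mul, hg' l hl, hh' l hl]; simp

theorem disp_inv_pure {p n : ℕ} {g : Equiv.Perm (Pts p n)} {k : Fin n} (hg : g ∈ tri p n)
    (hg' : ∀ l : Fin n, l ≠ k → disp g l = 0) :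
    disp g⁻¹ k = - disp g k ∧ ∀ l : Fin n, l ≠ k → disp g⁻¹ l = 0 := by
  have h0 : ∀ l : Fin n, l ≠ k → disp g⁻¹ l = 0 := fun l hl => by
    funext x; rw [disp_inv, hg' l hl]; simp
  refine ⟨?_, h0⟩
  funext x
  rw [disp_inv, hg k _ _ (agree_apply_self (fun l hl => h0 l (Fin.ne_of_lt hl)) x)]; rfl

/-- The functions `v` for which the shift of the coordinate `k` by `v` lies in `G`. -/
def shiftModule {p n : ℕ} [NeZero p] (G : Subgroup (Equiv.Perm (Pts p n))) (k : Fin n) :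
    Submodule (ZMod p) (Pts p n → ZMod p) where
  carrier := {v | v ∈ lowFn p n k ∧ ∃ g ∈ G, disp g k = v ∧ ∀ l : Fin n, l ≠ k → disp g l = 0}
  zero_mem' := ⟨zero_mem _, 1, one_mem _, by simp, by simp⟩
  add_mem' := by
    rintro _ _ ⟨hv, g, hg, rfl, hg'⟩ ⟨hw, h, hh, rfl, hh'⟩
    have := disp_mul_pure (mem_tri_of_pure hv hg') hg' hh'
    exact ⟨add_mem hv hw, g * h, mul_mem hg hh, this⟩
  smul_mem' := by
    rintro c _ ⟨hv, g, hg, rfl, hg'⟩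
    refine ⟨Submodule.smul_mem _ _ hv, g ^ c.val, pow_mem hg _, ?_, fun l hl =>
      disp_pow_eq_zero (hg' l hl) _⟩
    rw [(disp_pow_pure (mem_tri_of_pure hv hg') (fun l hl => hg' l hl.ne) _).2,
      ← Nat.cast_smul_eq_nsmul (ZMod p), ZMod.natCast_zmod_val]

theorem wreathP_mono {p n m m' : ℕ} (h : m ≤ m') : wreathP p n m ≤ wreathP p n m' :=
  Subgroup.closure_mono fun _ ⟨k, hk, e⟩ => ⟨k, hk.trans_le h, e⟩

/-- For the converse, induct on `m`: conjugating `sigma` at coordinate `m` by elements of the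
smaller wreath product gives the shifts by all indicator functions, which span `lowFn p n m`.
Dividing `g` by its shift of coordinate `m` leaves an element of the smaller group. -/
theorem mem_wreathP_iff {p n m : ℕ} [NeZero p] {g : Equiv.Perm (Pts p n)} :
    g ∈ wreathP p n m ↔ g ∈ tri p n ∧ ∀ k : Fin n, m ≤ k → disp g k = 0 := by
  constructor
  · intro h
    refine Subgroup.closure_induction (p := fun g _ => g ∈ tri p n ∧
      ∀ k : Fin n, m ≤ k → disp g k = 0) ?_ ?_ ?_ ?_ h
    · rintro _ ⟨k, hk, rfl⟩
      refine ⟨mem_tri_of_pure ((disp_sigma k).1 ▸ ind_mem _ _) (disp_sigma k).2, fun l hl => ?_⟩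
      exact (disp_sigma k).2 l (by rintro rfl; omega)
    · exact ⟨one_mem _, by simp⟩
    · rintro g h _ _ ⟨hg, hg'⟩ ⟨hh, hh'⟩
      refine ⟨mul_mem hg hh, fun k hk => ?_⟩
      funext x
      rw [disp_mul, hg' k hk, hh' k hk]; simp
    · rintro g _ ⟨hg, hg'⟩
      refine ⟨inv_mem hg, fun k hk => ?_⟩
      funext x
      rw [disp_inv, hg' k hk]; simp
  · rintro ⟨hg, hg'⟩
    induction m generalizing g with
    | zero =>
      have : g = 1 := ext_disp fun k => by simp [hg' k (Nat.zero_le _)]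
      rw [this]; exact one_mem _
    | succ m ih =>
      by_cases hm : m < n
      swap
      · exact wreathP_mono m.le_succ (ih hg fun k hk => absurd (hk.trans_lt k.isLt) hm)
      let k : Fin n := ⟨m, hm⟩
      have hind : ∀ c : Pts p n, ind m c ∈ shiftModule (wreathP p n (m + 1)) k := by
        intro c
        -- `t` carries the origin to a point agreeing with `c` on the first `m` coordinates, so
        -- conjugation by `t` turns `ind m 0` into `ind m c`.
        obtain ⟨t, ht, htd⟩ := exists_disp
          (fun (l : Fin n) (_ : Pts p n) => if (l : ℕ) < m then c l else 0)
          (fun k x y _ => rfl)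
        have ht' : ∀ l : Fin n, m ≤ l → disp t l = 0 := fun l hl => by
          rw [htd]; funext x; simp [not_lt.2 hl]
        have hc : Agree m (t 0) c := fun l hl => by
          rw [apply_eq_add_disp, htd]; simp [hl]
        have hs := disp_sigma (p := p) k
        have := disp_conj_pure ht (k := k) (fun l hl => ht' l (le_of_lt hl)) hs.2
        refine ⟨ind_mem _ _, t * sigma p n k * t⁻¹, ?_, ?_, this.2⟩
        · have h1 : t ∈ wreathP p n (m + 1) := wreathP_mono m.le_succ (ih ht ht')
          refine mul_mem (mul_mem h1 ?_) (inv_mem h1)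
          exact Subgroup.subset_closure ⟨k, Nat.lt_succ_self m, rfl⟩
        · rw [this.1, hs.1]
          funext x
          have h2 := ind_comp (m := m) (inv_mem ht) (t 0)
          rw [show t⁻¹ (t 0) = 0 from Equiv.symm_apply_apply t 0] at h2
          change (ind m 0 ∘ ⇑t⁻¹) x = _
          rw [h2]
          have : Agree m x (t 0) ↔ Agree m x c := ⟨fun h => h.trans hc, fun h => h.trans hc.symm⟩
          by_cases h : Agree m x c
          · simp [ind, h, this.2 h]
          · simp [ind, h, mt this.1 h]
      have hall : lowFn p n m ≤ shiftModule (wreathP p n (m + 1)) k := by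
        intro v hv
        rw [eq_sum_ind hv]
        exact Submodule.sum_mem _ fun c _ => by
          split_ifs
          · exact Submodule.smul_mem _ _ (hind c)
          · exact zero_mem _
      obtain ⟨_, a, ha, had, ha'⟩ := hall (hg k)
      have hat : a ∈ tri p n := mem_tri_of_pure (had ▸ hg k) ha'
      have hinv := disp_inv_pure hat ha'
      have hga : g * a⁻¹ ∈ wreathP p n m := by
        refine ih (mul_mem hg (inv_mem hat)) fun l hl => ?_
        have hag : ∀ x, Agree m (a⁻¹ x) x := agree_apply_self fun l hl =>
          hinv.2 l (Fin.ne_of_lt hl)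
        funext x
        rw [disp_mul]
        by_cases hlk : l = k
        · subst hlk
          rw [hg k _ _ (hag x), hinv.1, had]; simp
        · rw [hg' l, hinv.2 l hlk]
          · simp
          · exact Nat.succ_le_of_lt (lt_of_le_of_ne hl fun h => hlk (Fin.ext h.symm))
      have := mul_mem (wreathP_mono m.le_succ hga) ha
      simpa using this

theorem sylowP_eq_tri {p n : ℕ} [NeZero p] : sylowP p n = tri p n := by
  ext g
  rw [mem_wreathP_iff]
  exact ⟨fun h => h.1, fun h => ⟨h, fun k hk => absurd k.isLt (not_lt.2 hk)⟩⟩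

/-! ### Weir's subgroups as spaces of functions -/

/-- The lower series of the action of the triangular permutations on `lowFn p n k`. -/
def lowerFn (p n k : ℕ) : ℕ → Submodule (ZMod p) (Pts p n → ZMod p)
  | 0 => lowFn p n k
  | i + 1 => Submodule.span (ZMod p) {w | ∃ h ∈ tri p n, ∃ v ∈ lowerFn p n k i, w = v ∘ h - v}

theorem lowerFn_succ_le {p n k : ℕ} (i : ℕ) : lowerFn p n k (i + 1) ≤ lowerFn p n k i := by
  induction i with
  | zero =>
    refine Submodule.span_le.2 ?_
    rintro _ ⟨h, hh, v, hv, rfl⟩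
    exact sub_mem (comp_mem_lowFn hv hh) hv
  | succ i ih =>
    refine Submodule.span_le.2 ?_
    rintro _ ⟨h, hh, v, hv, rfl⟩
    exact Submodule.subset_span ⟨h, hh, v, ih hv, rfl⟩

theorem lowerFn_antitone {p n k : ℕ} : Antitone (lowerFn p n k) :=
  antitone_nat_of_succ_le lowerFn_succ_le

theorem lowerFn_le {p n k : ℕ} (i : ℕ) : lowerFn p n k i ≤ lowFn p n k :=
  lowerFn_antitone (Nat.zero_le i)

theorem sub_mem_lowerFn {p n k i : ℕ} {v : Pts p n → ZMod p} (hv : v ∈ lowerFn p n k i)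
    {h : Equiv.Perm (Pts p n)} (hh : h ∈ tri p n) : v ∘ h - v ∈ lowerFn p n k (i + 1) :=
  Submodule.subset_span ⟨h, hh, v, hv, rfl⟩

theorem comp_mem_lowerFn {p n k i : ℕ} {v : Pts p n → ZMod p} (hv : v ∈ lowerFn p n k i)
    {h : Equiv.Perm (Pts p n)} (hh : h ∈ tri p n) : v ∘ h ∈ lowerFn p n k i := by
  have := add_mem (lowerFn_succ_le i (sub_mem_lowerFn hv hh)) hv
  simpa using this

theorem mem_baseA_iff {p n : ℕ} {k : Fin n} {g : Equiv.Perm (Pts p n)} :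
    g ∈ baseA p n k ↔ disp g k ∈ lowFn p n k ∧ ∀ l : Fin n, l ≠ k → disp g l = 0 := by
  constructor
  · rintro ⟨f, hf⟩
    constructor
    · intro x y hxy
      have : firstCoords k x = firstCoords k y := funext fun l => hxy _ l.isLt
      simp [disp, hf, this]
    · intro l hl
      funext x
      simp [disp, hf, hl]
  · rintro ⟨h, h'⟩
    refine ⟨fun z => disp g k fun l => if hl : (l : ℕ) < k then z ⟨l, hl⟩ else 0, fun x => ?_⟩
    funext l
    by_cases hl : l = k
    · subst hl
      rw [Function.update_self, apply_eq_add_disp]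
      congr 1
      refine h _ _ fun m hm => ?_
      simp [hm, firstCoords]
    · rw [Function.update_of_ne hl, apply_eq_of_disp_eq_zero (h' l hl)]

/-- The commutator of `q` with the shift by `v` is the shift by `v ∘ q⁻¹ - v`. Letting all of `tri`
act instead of $P_{k+1}$ changes nothing, since functions in `lowFn p n k` only see the truncation
to the first `k` coordinates. -/
theorem mem_weirA_iff {p n : ℕ} [NeZero p] {k : Fin n} {i : ℕ} {g : Equiv.Perm (Pts p n)} :
    g ∈ weirA p n k i ↔ disp g k ∈ lowerFn p n k i ∧ ∀ l : Fin n, l ≠ k → disp g l = 0 := by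
  induction i generalizing g with
  | zero => exact mem_baseA_iff
  | succ i ih =>
    have hcomm : ∀ q ∈ wreathP p n (k + 1), ∀ a ∈ weirA p n k i,
        disp ⁅q, a⁆ k = disp a k ∘ ⇑q⁻¹ - disp a k ∧ ∀ l : Fin n, l ≠ k → disp ⁅q, a⁆ l = 0 := by
      intro q hq a ha
      obtain ⟨hq1, hq2⟩ := mem_wreathP_iff.1 hq
      obtain ⟨ha1, ha2⟩ := ih.1 ha
      have hat := mem_tri_of_pure (lowerFn_le i ha1) ha2
      have h1 := disp_conj_pure hq1 (fun l hl => hq2 l hl) ha2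
      have h2 := disp_inv_pure hat ha2
      have h3 := disp_mul_pure (mul_mem (mul_mem hq1 hat) (inv_mem hq1)) h1.2 h2.2
      rw [commutatorElement_def]
      refine ⟨?_, h3.2⟩
      rw [h3.1, h1.1, h2.1, sub_eq_add_neg]
    constructor
    · intro hg
      refine Subgroup.closure_induction (p := fun g _ => disp g k ∈ lowerFn p n k (i + 1) ∧
        ∀ l : Fin n, l ≠ k → disp g l = 0) ?_ ?_ ?_ ?_ hg
      · rintro _ ⟨q, hq, a, ha, rfl⟩
        obtain ⟨h1, h2⟩ := hcomm q hq a ha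
        exact ⟨h1 ▸ sub_mem_lowerFn (ih.1 ha).1 (inv_mem (mem_wreathP_iff.1 hq).1), h2⟩
      · simp
      · rintro g h _ _ ⟨hg, hg'⟩ ⟨hh, hh'⟩
        have := disp_mul_pure (mem_tri_of_pure (lowerFn_le _ hg) hg') hg' hh'
        exact ⟨this.1 ▸ add_mem hg hh, this.2⟩
      · rintro g _ ⟨hg, hg'⟩
        have := disp_inv_pure (mem_tri_of_pure (lowerFn_le _ hg) hg') hg'
        exact ⟨this.1 ▸ neg_mem hg, this.2⟩
    · rintro ⟨hg, hg'⟩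
      have hle : lowerFn p n k (i + 1) ≤ shiftModule (weirA p n k (i + 1)) k := by
        refine Submodule.span_le.2 ?_
        rintro _ ⟨h, hh, v, hv, rfl⟩
        refine ⟨sub_mem (comp_mem_lowFn (lowerFn_le i hv) hh) (lowerFn_le i hv), ?_⟩
        obtain ⟨q, hq, hq1, hq2⟩ := exists_trunc (k : ℕ) hh
        obtain ⟨a, -, ha1, ha2⟩ := exists_pure (k := k) (lowerFn_le i hv)
        have hqP : q⁻¹ ∈ wreathP p n (k + 1) :=
          inv_mem (mem_wreathP_iff.2 ⟨hq, fun l hl => hq2 l (by omega)⟩)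
        have haA : a ∈ weirA p n k i := ih.2 ⟨ha1 ▸ hv, ha2⟩
        obtain ⟨h1, h2⟩ := hcomm _ hqP a haA
        refine ⟨⁅q⁻¹, a⁆, Subgroup.commutator_mem_commutator hqP haA, ?_, h2⟩
        rw [h1, ha1, inv_inv]
        congr 1
        funext x
        exact lowerFn_le i hv _ _ (agree_trunc hq1 x)
      obtain ⟨-, b, hb, hb1, hb2⟩ := hle hg
      have : g = b := ext_disp fun l => by
        by_cases hl : l = k
        · subst hl; exact hb1.symm
        · rw [hg' l hl, hb2 l hl]
      exact this ▸ hb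

/-- The increasing order matters: the factors to the right of the one at `a` fix all coordinates up
to `a`, so each displacement of the product comes from a single factor. -/
theorem mem_prod_weirA_iff {p n : ℕ} [NeZero p] (i : Fin n → ℕ) (L : List (Fin n))
    (hL : L.Pairwise (· < ·)) (g : Equiv.Perm (Pts p n)) :
    g ∈ (L.map fun k => (weirA p n k (i k) : Set (Equiv.Perm (Pts p n)))).prod ↔
      (∀ k ∈ L, disp g k ∈ lowerFn p n k (i k)) ∧ ∀ k : Fin n, k ∉ L → disp g k = 0 := by
  induction L generalizing g with
  | nil =>
    simp only [List.map_nil, List.prod_nil, Set.mem_one, List.not_mem_nil, false_implies,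
      implies_true, true_and, not_false_eq_true, true_implies]
    exact ⟨by rintro rfl; simp, fun h => ext_disp fun k => by simp [h k]⟩
  | cons a L ih =>
    rw [List.pairwise_cons] at hL
    have haL : a ∉ L := fun h => lt_irrefl a (hL.1 a h)
    rw [List.map_cons, List.prod_cons, Set.mem_mul]
    constructor
    · rintro ⟨b, hb, h, hh, rfl⟩
      obtain ⟨hb1, hb2⟩ := mem_weirA_iff.1 hb
      obtain ⟨hh1, hh2⟩ := (ih hL.2 h).1 hh
      have hag : ∀ x, Agree a (h x) x := agree_apply_self fun l hl =>
        hh2 l fun hl' => lt_asymm hl (hL.1 l hl')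
      have hda : disp (b * h) a = disp b a := by
        funext x
        rw [disp_mul, hh2 a haL, lowerFn_le _ hb1 _ _ (hag x)]; simp
      have hdl : ∀ l : Fin n, l ≠ a → disp (b * h) l = disp h l := fun l hl => by
        funext x
        rw [disp_mul, hb2 l hl]; simp
      refine ⟨fun k hk => ?_, fun k hk => ?_⟩
      · rcases List.mem_cons.1 hk with rfl | hk
        · exact hda ▸ hb1
        · rw [hdl k fun h => haL (h ▸ hk)]
          exact hh1 k hk
      · rw [List.mem_cons, not_or] at hk
        rw [hdl k hk.1, hh2 k hk.2]
    · rintro ⟨h1, h2⟩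
      have hga := h1 a List.mem_cons_self
      obtain ⟨b, hbt, hb1, hb2⟩ := exists_pure (lowerFn_le _ hga)
      have hbi := disp_inv_pure hbt hb2
      refine ⟨b, mem_weirA_iff.2 ⟨hb1 ▸ hga, hb2⟩, b⁻¹ * g, ?_, by simp⟩
      have hag : ∀ x, Agree a (g x) x := agree_apply_self fun l hl =>
        h2 l fun hl' => by
          rcases List.mem_cons.1 hl' with rfl | h
          · exact lt_irrefl _ hl
          · exact lt_asymm hl (hL.1 l h)
      have hda : disp (b⁻¹ * g) a = 0 := by
        funext x
        rw [disp_mul, hbi.1, hb1, Pi.neg_apply, lowerFn_le _ hga _ _ (hag x)]; simp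
      have hdl : ∀ l : Fin n, l ≠ a → disp (b⁻¹ * g) l = disp g l := fun l hl => by
        funext x
        rw [disp_mul, hbi.2 l hl]; simp
      refine (ih hL.2 _).2 ⟨fun k hk => ?_, fun k hk => ?_⟩
      · rw [hdl k fun h => haL (h ▸ hk)]
        exact h1 k (List.mem_cons_of_mem _ hk)
      · by_cases hka : k = a
        · exact hka ▸ hda
        · rw [hdl k hka]
          exact h2 k (by simp [hka, hk])

theorem mem_partitionProduct_iff {p n : ℕ} [NeZero p] {j : Fin n} {i : Fin n → ℕ}
    {g : Equiv.Perm (Pts p n)} :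
    g ∈ partitionProduct p n j i ↔
      (∀ k : Fin n, j ≤ k → disp g k ∈ lowerFn p n k (i k)) ∧ ∀ k : Fin n, k < j → disp g k = 0 := by
  rw [partitionProduct, mem_prod_weirA_iff]
  · simp
  · exact (List.pairwise_lt_finRange n).filter _

/-! ### Strict descent of the lower series -/

theorem eq_bot_of_commutator_eq_self {G : Type*} [Group G] {Q A : Subgroup G}
    [Group.IsNilpotent Q] (hA : A ≤ Q) (h : ⁅Q, A⁆ = A) : A = ⊥ := by
  obtain ⟨m, hm⟩ := (Subgroup.isNilpotent_iff_lowerCentralSeries Q).1 ‹_›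
  have key : ∀ m, A ≤ Q.lowerCentralSeries m := by
    intro m
    induction m with
    | zero => exact hA
    | succ m ih =>
      rw [Subgroup.lowerCentralSeries_succ, ← h, Subgroup.commutator_comm]
      exact Subgroup.commutator_mono ih le_rfl
  exact le_bot_iff.1 (hm ▸ key m)

/-- Once the first coordinates are fixed, the shift of the next one is unchanged under iteration, so
a further `p`-th power multiplies it by `p = 0`. -/
theorem pow_eq_one_of_mem_tri {p n : ℕ} {g : Equiv.Perm (Pts p n)} (hg : g ∈ tri p n) :
    g ^ p ^ n = 1 := by
  have key : ∀ m, ∀ l : Fin n, (l : ℕ) < m → disp (g ^ p ^ m) l = 0 := by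
    intro m
    induction m with
    | zero => intro l hl; omega
    | succ m ih =>
      intro l hl
      have := disp_pow_pure (k := l) (pow_mem hg (p ^ m)) (fun l' hl' => ih l' (by omega)) p
      rw [pow_succ, pow_mul, this.2]
      funext x
      rw [Pi.smul_apply]
      simp
  exact ext_disp fun k => by rw [key n k k.isLt, disp_one]

theorem isPGroup_wreathP {p n m : ℕ} [NeZero p] : IsPGroup p (wreathP p n m) := fun g =>
  ⟨n, Subtype.ext (pow_eq_one_of_mem_tri (mem_wreathP_iff.1 g.2).1)⟩

/-- $P_{k+1}$ is a finite $p$-group, hence nilpotent, so $[P_{k+1}, A^k_i] = A^k_i$ forces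
triviality. -/
theorem lowerFn_eq_bot_of_succ_eq {p n : ℕ} [Fact p.Prime] {k : Fin n} {i : ℕ}
    (h : lowerFn p n k (i + 1) = lowerFn p n k i) : lowerFn p n k i = ⊥ := by
  have hQ : Group.IsNilpotent (wreathP p n (k + 1)) := isPGroup_wreathP.isNilpotent
  have hA : weirA p n k i = ⊥ := by
    refine eq_bot_of_commutator_eq_self (Q := wreathP p n (k + 1)) ?_ ?_
    · intro g hg
      obtain ⟨h1, h2⟩ := mem_weirA_iff.1 hg
      exact mem_wreathP_iff.2 ⟨mem_tri_of_pure (lowerFn_le _ h1) h2,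
        fun l hl => h2 l (by rintro rfl; omega)⟩
    · change weirA p n k (i + 1) = _
      ext g
      rw [mem_weirA_iff, mem_weirA_iff, h]
  refine (Submodule.eq_bot_iff _).2 fun v hv => ?_
  obtain ⟨g, -, h1, h2⟩ := exists_pure (lowerFn_le i hv)
  have : g ∈ weirA p n k i := mem_weirA_iff.2 ⟨h1 ▸ hv, h2⟩
  rw [hA, Subgroup.mem_bot] at this
  rw [← h1, this, disp_one]

theorem lowerFn_injective_of_ne_bot {p n : ℕ} [Fact p.Prime] {k : Fin n} {a b : ℕ}
    (h : lowerFn p n k a = lowerFn p n k b) (h0 : lowerFn p n k a ≠ ⊥) : a = b := by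
  rcases lt_trichotomy a b with hab | hab | hab
  · refine absurd (lowerFn_eq_bot_of_succ_eq (le_antisymm (lowerFn_succ_le a) ?_)) h0
    rw [h]; exact lowerFn_antitone hab
  · exact hab
  · refine absurd (h.trans (lowerFn_eq_bot_of_succ_eq (le_antisymm (lowerFn_succ_le b) ?_))) h0
    rw [← h]; exact lowerFn_antitone hab

theorem finrank_lowFn_le {p n : ℕ} [Fact p.Prime] (k : Fin n) :
    Module.finrank (ZMod p) (lowFn p n k) ≤ p ^ (k : ℕ) := by
  let e : Pts p k → Pts p n := fun z l => if hl : (l : ℕ) < k then z ⟨l, hl⟩ else 0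
  let f : lowFn p n k →ₗ[ZMod p] (Pts p k → ZMod p) :=
    (LinearMap.funLeft (ZMod p) (ZMod p) e).comp (lowFn p n k).subtype
  have hf : Function.Injective f := by
    intro v w h
    ext x
    have h1 := congrFun h (firstCoords k x)
    have h2 : Agree k x (e (firstCoords k x)) := fun l hl => by
      simp only [e, dif_pos hl]; rfl
    rw [v.2 _ _ h2, w.2 _ _ h2]
    exact h1
  have := LinearMap.finrank_le_finrank_of_injective hf
  simpa using this

/-- The dimension starts at most at `p ^ k` and drops at every step until it is zero. -/
theorem lowerFn_pow_eq_bot {p n : ℕ} [Fact p.Prime] (k : Fin n) :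
    lowerFn p n k (p ^ (k : ℕ)) = ⊥ := by
  have key : ∀ i, lowerFn p n k i = ⊥ ∨
      Module.finrank (ZMod p) (lowerFn p n k i) + i ≤ p ^ (k : ℕ) := by
    intro i
    induction i with
    | zero => exact Or.inr (finrank_lowFn_le k)
    | succ i ih =>
      by_cases h0 : lowerFn p n k i = ⊥
      · exact Or.inl (le_bot_iff.1 (h0 ▸ lowerFn_succ_le i))
      · have hlt : lowerFn p n k (i + 1) < lowerFn p n k i :=
          lt_of_le_of_ne (lowerFn_succ_le i) fun h => h0 (lowerFn_eq_bot_of_succ_eq h)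
        have := Submodule.finrank_lt_finrank_of_lt hlt
        have := ih.resolve_left h0
        right; omega
  rcases key (p ^ (k : ℕ)) with h | h
  · exact h
  · exact Submodule.finrank_eq_zero.1 (by omega)

/-! ### The odometer, invariant spaces and descent by $p^j$ steps -/

/-- The base `p` digits of a natural number, least significant first. -/
def digitPt (p n N : ℕ) : Pts p n := fun l => ((N / p ^ (l : ℕ) : ℕ) : ZMod p)

/-- This is the carry rule: adding one changes digit `k` exactly when all lower digits are `p - 1`.
-/
theorem forall_digit_eq_neg_one_iff {p : ℕ} [Fact p.Prime] (N k : ℕ) :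
    (∀ l < k, ((N / p ^ l : ℕ) : ZMod p) = -1) ↔ p ^ k ∣ N + 1 := by
  induction k with
  | zero => simp
  | succ k ih =>
    have h1 : (∀ l < k + 1, ((N / p ^ l : ℕ) : ZMod p) = -1) ↔
        (∀ l < k, ((N / p ^ l : ℕ) : ZMod p) = -1) ∧ ((N / p ^ k : ℕ) : ZMod p) = -1 :=
      Nat.forall_lt_succ_right
    rw [h1, ih]
    constructor
    · rintro ⟨h, h'⟩
      have h2 : (N + 1) / p ^ k = N / p ^ k + 1 := by rw [Nat.succ_div, if_pos h]
      have h3 : p ∣ (N + 1) / p ^ k := by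
        rw [← ZMod.natCast_eq_zero_iff, h2, Nat.cast_add, h']; simp
      obtain ⟨c, hc⟩ := h3
      exact ⟨c, by rw [← Nat.mul_div_cancel' h, hc]; ring⟩
    · rintro ⟨c, hc⟩
      have h : p ^ k ∣ N + 1 := ⟨p * c, by rw [hc]; ring⟩
      have h2 : (N + 1) / p ^ k = N / p ^ k + 1 := by rw [Nat.succ_div, if_pos h]
      have h3 : (N + 1) / p ^ k = p * c := by
        rw [hc, pow_succ, mul_assoc]
        exact Nat.mul_div_cancel_left _ (pow_pos (Nat.Prime.pos Fact.out) _)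
      refine ⟨h, eq_neg_of_add_eq_zero_left ?_⟩
      have : ((N / p ^ k + 1 : ℕ) : ZMod p) = 0 := by
        rw [← h2, h3]; simp
      simpa using this

/-- The adding machine. -/
theorem exists_odometer (p n : ℕ) [Fact p.Prime] :
    ∃ g ∈ tri p n, ∀ N, g (digitPt p n N) = digitPt p n (N + 1) := by
  obtain ⟨g, hg, hd⟩ := exists_disp (p := p) (n := n) (fun k => ind k (fun _ => -1))
    fun k => ind_mem _ _
  refine ⟨g, hg, fun N => funext fun k => ?_⟩
  rw [apply_eq_add_disp, hd]
  have h : Agree k (digitPt p n N) (fun _ => -1) ↔ p ^ (k : ℕ) ∣ N + 1 := by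
    rw [← forall_digit_eq_neg_one_iff]
    exact ⟨fun h l hl => h ⟨l, hl.trans k.isLt⟩ hl, fun h l hl => h l hl⟩
  by_cases hdiv : p ^ (k : ℕ) ∣ N + 1
  · simp [ind, h.2 hdiv, digitPt, Nat.succ_div, hdiv]
  · simp [ind, mt h.1 hdiv, digitPt, Nat.succ_div, hdiv]

theorem digitPt_surjective (p n : ℕ) [Fact p.Prime] : Function.Surjective (digitPt p n) := by
  intro x
  have key : ∀ m, ∃ N, Agree m (digitPt p n N) x := by
    intro m
    induction m with
    | zero => exact ⟨0, fun l hl => absurd hl (Nat.not_lt_zero _)⟩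
    | succ m ih =>
      obtain ⟨N, hN⟩ := ih
      by_cases hm : m < n
      swap
      · exact ⟨N, fun l hl => hN l (by omega)⟩
      refine ⟨N + p ^ m * (x ⟨m, hm⟩ - digitPt p n N ⟨m, hm⟩).val, fun l hl => ?_⟩
      rcases Nat.lt_succ_iff_lt_or_eq.1 hl with hl | hl
      · rw [← hN l hl, digitPt, digitPt]
        obtain ⟨t, rfl⟩ : ∃ t, m = l + 1 + t := ⟨m - l - 1, by omega⟩
        rw [pow_add, pow_add, pow_one, mul_assoc, mul_assoc,
          Nat.add_mul_div_left _ _ (pow_pos (Nat.Prime.pos Fact.out) _)]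
        simp [digitPt]
      · obtain rfl : l = ⟨m, hm⟩ := Fin.ext hl
        rw [digitPt, Nat.add_mul_div_left _ _ (pow_pos (Nat.Prime.pos Fact.out) _)]
        simp [digitPt]
  obtain ⟨N, hN⟩ := key n
  exact ⟨N, hN.eq le_rfl⟩

theorem agree_digitPt_iff {p n m : ℕ} (hm : m ≤ n) [Fact p.Prime] {N M : ℕ} :
    Agree m (digitPt p n N) (digitPt p n M) ↔ N ≡ M [MOD p ^ m] := by
  induction m with
  | zero => exact ⟨fun _ => by simp [Nat.ModEq, Nat.mod_one], fun _ l hl => absurd hl (by omega)⟩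
  | succ m ih =>
    have hp : 0 < p := Nat.Prime.pos Fact.out
    have h1 : Agree (m + 1) (digitPt p n N) (digitPt p n M) ↔
        Agree m (digitPt p n N) (digitPt p n M) ∧ N / p ^ m ≡ M / p ^ m [MOD p] := by
      rw [← ZMod.natCast_eq_natCast_iff]
      constructor
      · exact fun h => ⟨h.mono m.le_succ, h ⟨m, hm⟩ (Nat.lt_succ_self m)⟩
      · rintro ⟨h, h'⟩ l hl
        rcases Nat.lt_succ_iff_lt_or_eq.1 hl with hl | hl
        · exact h l hl
        · obtain rfl : l = ⟨m, hm⟩ := Fin.ext hl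
          exact h'
    rw [h1, ih (Nat.le_of_succ_le hm)]
    unfold Nat.ModEq
    rw [Nat.mod_pow_succ, Nat.mod_pow_succ]
    constructor
    · rintro ⟨h, h'⟩; rw [h, h']
    · intro h
      have hpos : 0 < p ^ m := pow_pos hp m
      have e : N % p ^ m = M % p ^ m := by
        have := congrArg (· % p ^ m) h
        simpa using this
      refine ⟨e, ?_⟩
      rw [e] at h
      exact Nat.eq_of_mul_eq_mul_left hpos (Nat.add_left_cancel h)

theorem pow_odometer {p n : ℕ} {g : Equiv.Perm (Pts p n)}
    (hg : ∀ N, g (digitPt p n N) = digitPt p n (N + 1)) (t N : ℕ) :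
    (g ^ t) (digitPt p n N) = digitPt p n (N + t) := by
  induction t with
  | zero => rfl
  | succ t ih => rw [pow_succ', Equiv.Perm.mul_apply, ih, hg]; rfl

/-- The powers of the odometer by multiples of `p ^ j` are transitive on the points
with given first `j` coordinates. -/
theorem exists_pow_odometer {p n j : ℕ} [Fact p.Prime] {g : Equiv.Perm (Pts p n)}
    (hg : ∀ N, g (digitPt p n N) = digitPt p n (N + 1)) (hj : j ≤ n) {x y : Pts p n}
    (h : Agree j x y) : ∃ t, (g ^ (p ^ j * t)) x = y := by
  obtain ⟨N, rfl⟩ := digitPt_surjective p n x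
  obtain ⟨M, rfl⟩ := digitPt_surjective p n y
  have hp : 0 < p := Nat.Prime.pos Fact.out
  -- Adding a multiple of `p ^ n` to `M` keeps the point and makes the difference with `N` a natural
  -- number.
  have h1 : digitPt p n (M + p ^ n * N) = digitPt p n M :=
    ((agree_digitPt_iff le_rfl).2 (by simp [Nat.ModEq])).eq le_rfl
  have h2 : N ≡ M + p ^ n * N [MOD p ^ j] := (agree_digitPt_iff hj).1 (h1.symm ▸ h)
  have hle : N ≤ M + p ^ n * N :=
    le_add_left (Nat.le_mul_of_pos_left N (pow_pos hp n))
  obtain ⟨t, ht⟩ := (Nat.modEq_iff_dvd' hle).1 h2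
  refine ⟨t, ?_⟩
  rw [pow_odometer hg, ← ht, Nat.add_sub_cancel' hle, h1]

theorem funLeft_pow {α : Type*} (R : Type*) [CommRing R] (g : Equiv.Perm α) (t : ℕ) :
    (LinearMap.funLeft R R g) ^ t = LinearMap.funLeft R R ⇑(g ^ t) := by
  induction t with
  | zero => ext; rfl
  | succ t ih =>
    rw [pow_succ, ih]
    ext v x
    simp only [Module.End.mul_apply, LinearMap.funLeft_apply, pow_succ', Equiv.Perm.mul_apply]

/-- The Frobenius identity in the commutative ring of polynomials, evaluated at `L`. -/
theorem sub_one_pow_char_pow {p : ℕ} [Fact p.Prime] {V : Type*} [AddCommGroup V]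
    [Module (ZMod p) V] (L : Module.End (ZMod p) V) (j : ℕ) :
    (L - 1) ^ p ^ j = L ^ p ^ j - 1 := by
  have := sub_pow_char_pow (R := Polynomial (ZMod p)) (p := p) Polynomial.X 1 (n := j)
  simpa using congrArg (Polynomial.aeval L) this

/-- A non-zero space of functions invariant under `tri` contains the constants. -/
theorem one_mem_of_invariant {p n : ℕ} [Fact p.Prime]
    {M : Submodule (ZMod p) (Pts p n → ZMod p)}
    (hM : ∀ v ∈ M, ∀ g ∈ tri p n, v ∘ g ∈ M) (h0 : M ≠ ⊥) : (1 : Pts p n → ZMod p) ∈ M := by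
  obtain ⟨g, hg, hgN⟩ := exists_odometer p n
  let D : Module.End (ZMod p) (Pts p n → ZMod p) := LinearMap.funLeft (ZMod p) (ZMod p) g - 1
  have hDv : ∀ v, D v = v ∘ g - v := fun v => rfl
  have hD0 : D ^ p ^ n = 0 := by
    rw [sub_one_pow_char_pow, funLeft_pow, pow_eq_one_of_mem_tri hg]
    ext; simp
  have hDM : ∀ v ∈ M, D v ∈ M := fun v hv => hDv v ▸ sub_mem (hM v hv g hg) hv
  have hDM' : ∀ t, ∀ v ∈ M, (D ^ t) v ∈ M := by
    intro t
    induction t with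
    | zero => exact fun v hv => hv
    | succ t ih => exact fun v hv => by rw [pow_succ']; exact hDM _ (ih v hv)
  obtain ⟨v, hv, hv0⟩ := (Submodule.ne_bot_iff M).1 h0
  classical
  have hex : ∃ t, (D ^ t) v = 0 := ⟨p ^ n, by rw [hD0]; rfl⟩
  obtain ⟨t, ht⟩ : ∃ t, Nat.find hex = t + 1 := by
    refine Nat.exists_eq_succ_of_ne_zero fun h => hv0 ?_
    have := Nat.find_spec hex
    rw [h] at this
    exact this
  have hne : (D ^ t) v ≠ 0 := Nat.find_min hex (by omega)
  have hfix : D ((D ^ t) v) = 0 := by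
    have := Nat.find_spec hex
    rw [ht, pow_succ'] at this
    exact this
  set w := (D ^ t) v with hw
  have hinv : ∀ x, w (g x) = w x := fun x => by
    rw [hDv, sub_eq_zero] at hfix
    exact congrFun hfix x
  have hconst : ∀ N, w (digitPt p n N) = w (digitPt p n 0) := by
    intro N
    induction N with
    | zero => rfl
    | succ N ih => rw [← hgN, hinv, ih]
  have hc : w = w (digitPt p n 0) • (1 : Pts p n → ZMod p) := by
    funext x
    obtain ⟨N, rfl⟩ := digitPt_surjective p n x
    simp [hconst N]
  have hc0 : w (digitPt p n 0) ≠ 0 := fun h => hne (by rw [hc, h, zero_smul])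
  have hwM : w ∈ M := hDM' t v hv
  rw [hc] at hwM
  exact (Submodule.smul_mem_iff _ hc0).1 hwM

/-- With `g` the odometer acting on functions, $(g-1)^{p^j} = g^{p^j} - 1$ descends $p^j$ steps of
the series, and the powers of $g^{p^j}$ are transitive on points with the same first `j`
coordinates. -/
theorem ind_sub_ind_mem_lowerFn {p n j k : ℕ} [Fact p.Prime] (hj : j ≤ n) {x y : Pts p n}
    (h : Agree j x y) : ind k y - ind k x ∈ lowerFn p n k (p ^ j) := by
  obtain ⟨g, hg, hgN⟩ := exists_odometer p n
  let D : Module.End (ZMod p) (Pts p n → ZMod p) := LinearMap.funLeft (ZMod p) (ZMod p) g - 1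
  have hDv : ∀ v, D v = v ∘ g - v := fun v => rfl
  have hD : ∀ t, ∀ v ∈ lowFn p n k, (D ^ t) v ∈ lowerFn p n k t := by
    intro t
    induction t with
    | zero => exact fun v hv => hv
    | succ t ih =>
      intro v hv
      rw [pow_succ', Module.End.mul_apply, hDv]; exact sub_mem_lowerFn (ih v hv) hg
  have hq : ∀ v ∈ lowFn p n k, v ∘ ⇑(g ^ p ^ j) - v ∈ lowerFn p n k (p ^ j) := by
    intro v hv
    have := hD (p ^ j) v hv
    rwa [sub_one_pow_char_pow, funLeft_pow] at this
  have hqt : ∀ t, ∀ v ∈ lowFn p n k, v ∘ ⇑(g ^ (p ^ j * t)) - v ∈ lowerFn p n k (p ^ j) := by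
    intro t
    induction t with
    | zero => intro v _; simp
    | succ t ih =>
      intro v hv
      have h1 := hq _ (comp_mem_lowFn hv (pow_mem hg (p ^ j * t)))
      have h2 := add_mem h1 (ih v hv)
      have h3 : (v ∘ ⇑(g ^ (p ^ j * t))) ∘ ⇑(g ^ p ^ j) = v ∘ ⇑(g ^ (p ^ j * (t + 1))) := by
        rw [mul_add, mul_one, pow_add]; rfl
      rw [h3] at h2
      simpa using h2
  obtain ⟨t, ht⟩ := exists_pow_odometer hgN hj h.symm
  have := hqt t _ (ind_mem k x)
  rw [← ht, ind_comp (pow_mem hg _), ht] at this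
  exact this

/-! ### Fibre sums and the $p^j$-th term of the lower series -/

open Classical in
/-- Summation over the coordinates `j, …, k - 1`. -/
noncomputable def fiberSum {p n : ℕ} [NeZero p] (j k : ℕ) :
    (Pts p n → ZMod p) →ₗ[ZMod p] (Pts p n → ZMod p) where
  toFun v x := ∑ y : Pts p n, if Agree j y x ∧ res k y = y then v y else 0
  map_add' v w := by
    funext x
    rw [Pi.add_apply, ← Finset.sum_add_distrib]
    exact Finset.sum_congr rfl fun y _ => by split_ifs <;> simp
  map_smul' c v := by
    funext x
    rw [RingHom.id_apply, Pi.smul_apply, Finset.smul_sum]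
    exact Finset.sum_congr rfl fun y _ => by split_ifs <;> simp

open Classical in
theorem fiberSum_apply {p n : ℕ} [NeZero p] (j k : ℕ) (v : Pts p n → ZMod p) (x : Pts p n) :
    fiberSum j k v x = ∑ y : Pts p n, if Agree j y x ∧ res k y = y then v y else 0 := rfl

theorem fiberSum_mem {p n : ℕ} [NeZero p] (j k : ℕ) (v : Pts p n → ZMod p) :
    fiberSum j k v ∈ lowFn p n j := by
  classical
  intro x x' h
  rw [fiberSum_apply, fiberSum_apply]
  refine Finset.sum_congr rfl fun y _ => ?_
  have : Agree j y x ↔ Agree j y x' := ⟨fun h' => h'.trans h, fun h' => h'.trans h.symm⟩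
  rw [this]

/-- After truncating `g` to its first `k` coordinates, it permutes the representatives `res k y =
y`, so the sum can be reindexed. -/
theorem fiberSum_comp {p n : ℕ} [NeZero p] {j k : ℕ} (hjk : j ≤ k) {v : Pts p n → ZMod p}
    (hv : v ∈ lowFn p n k) {g : Equiv.Perm (Pts p n)} (hg : g ∈ tri p n) :
    fiberSum j k (v ∘ g) = fiberSum j k v ∘ g := by
  classical
  obtain ⟨h, hh, h1, h2⟩ := exists_trunc k hg
  have hag := agree_trunc h1
  have e1 : v ∘ g = v ∘ h := funext fun x => (hv _ _ (hag x)).symm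
  have e2 : fiberSum j k v ∘ g = fiberSum j k v ∘ h := funext fun x =>
    (fiberSum_mem j k v _ _ ((hag x).mono hjk)).symm
  rw [e1, e2]
  funext x
  rw [Function.comp_apply, fiberSum_apply, fiberSum_apply,
    ← Equiv.sum_comp h fun y => if Agree j y (h x) ∧ res k y = y then v y else 0]
  refine Finset.sum_congr rfl fun y _ => ?_
  have e3 : res k (h y) = h y ↔ res k y = y := by
    rw [res_eq_self_iff, res_eq_self_iff]
    refine forall_congr' fun l => imp_congr_right fun hl => ?_
    rw [apply_eq_of_disp_eq_zero (h2 l hl)]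
  exact (if_congr (and_congr (agree_apply_iff hh) e3) rfl rfl).symm

/-- The kernel of `fiberSum` is spanned by differences of indicator functions. -/
theorem mem_of_fiberSum_eq_zero {p n : ℕ} [NeZero p] {j k : ℕ} (hjk : j ≤ k)
    {M : Submodule (ZMod p) (Pts p n → ZMod p)}
    (hM : ∀ x y : Pts p n, Agree j x y → ind k y - ind k x ∈ M)
    {v : Pts p n → ZMod p} (hv : v ∈ lowFn p n k) (h0 : fiberSum j k v = 0) : v ∈ M := by
  classical
  -- Each point is compared with the base point `res j c` of its fibre; the vanishing fibre sums
  -- make the contributions at the base points cancel.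
  have h1 : ∑ c : Pts p n, (if res k c = c then v c • ind k (res j c) else 0) = 0 := by
    funext z
    rw [Finset.sum_apply, Pi.zero_apply]
    by_cases hz : Agree k z (res j z)
    · refine Eq.trans ?_ (congrFun h0 z)
      rw [fiberSum_apply]
      refine Finset.sum_congr rfl fun c _ => ?_
      have h2 : Agree k z (res j c) ↔ Agree j c z := by
        constructor
        · exact fun h => ((h.mono hjk).trans (agree_res j c)).symm
        · intro h; rw [res_eq_res_iff.2 h]; exact hz
      by_cases hc : res k c = c <;> by_cases hcz : Agree j c z
      · rw [if_pos hc, if_pos ⟨hcz, hc⟩, Pi.smul_apply, ind, if_pos (h2.2 hcz), smul_eq_mul,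
          mul_one]
      · rw [if_pos hc, if_neg fun h => hcz h.1, Pi.smul_apply, ind, if_neg (mt h2.1 hcz),
          smul_zero]
      · rw [if_neg hc, if_neg fun h => hc h.2]; rfl
      · rw [if_neg hc, if_neg fun h => hc h.2]; rfl
    · refine Finset.sum_eq_zero fun c _ => ?_
      split_ifs with hc
      · have : ¬ Agree k z (res j c) := fun h => hz (by
          have h3 : Agree j c z := ((h.mono hjk).trans (agree_res j c)).symm
          rw [← res_eq_res_iff.2 h3]; exact h)
        rw [Pi.smul_apply, ind, if_neg this, smul_zero]
      · rfl
  have h2 : v = ∑ c : Pts p n, if res k c = c then v c • (ind k c - ind k (res j c)) else 0 := by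
    refine ((eq_sum_ind hv).trans (sub_zero _).symm).trans ?_
    rw [← h1, ← Finset.sum_sub_distrib]
    refine Finset.sum_congr rfl fun c _ => ?_
    split_ifs
    · rw [smul_sub]
    · rw [sub_zero]
  rw [h2]
  refine Submodule.sum_mem _ fun c _ => ?_
  split_ifs
  · exact Submodule.smul_mem _ _ (hM _ _ (agree_res j c))
  · exact zero_mem _

theorem fiberSum_mem_lowerFn {p n : ℕ} [NeZero p] {j k : ℕ} (hjk : j ≤ k) (i : ℕ)
    {v : Pts p n → ZMod p} (hv : v ∈ lowerFn p n k i) : fiberSum j k v ∈ lowerFn p n j i := by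
  induction i generalizing v with
  | zero => exact fiberSum_mem j k v
  | succ i ih =>
    have : lowerFn p n k (i + 1) ≤ (lowerFn p n j (i + 1)).comap (fiberSum j k) := by
      refine Submodule.span_le.2 ?_
      rintro _ ⟨h, hh, w, hw, rfl⟩
      rw [SetLike.mem_coe, Submodule.mem_comap, map_sub, fiberSum_comp hjk (lowerFn_le i hw) hh]
      exact sub_mem_lowerFn (ih hw) hh
    exact this hv

/-- Equivariance sends the $p^j$-th term at `k` into the $p^j$-th term at `j`, which is zero.
Conversely, the kernel is spanned by differences of indicators, which lie that deep. -/
theorem mem_lowerFn_pow_iff {p n : ℕ} [Fact p.Prime] {j k : Fin n} (hjk : j ≤ k)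
    {v : Pts p n → ZMod p} :
    v ∈ lowerFn p n k (p ^ (j : ℕ)) ↔ v ∈ lowFn p n k ∧ fiberSum j k v = 0 := by
  constructor
  · intro h
    refine ⟨lowerFn_le _ h, ?_⟩
    have := fiberSum_mem_lowerFn (j := j) hjk _ h
    rwa [lowerFn_pow_eq_bot, Submodule.mem_bot] at this
  · rintro ⟨h, h'⟩
    exact mem_of_fiberSum_eq_zero (j := j) hjk
      (fun x y hxy => ind_sub_ind_mem_lowerFn j.isLt.le hxy) h h'

theorem lowerFn_pow_ne_bot {p n : ℕ} [Fact p.Prime] {j k : Fin n} (hjk : j < k) :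
    lowerFn p n k (p ^ (j : ℕ)) ≠ ⊥ := by
  have h : Agree j (0 : Pts p n) (Pi.single j 1) := fun l hl => by
    rw [Pi.single_eq_of_ne (Fin.ne_of_lt hl)]; rfl
  refine (Submodule.ne_bot_iff _).2 ⟨_, ind_sub_ind_mem_lowerFn (k := k) j.isLt.le h, ?_⟩
  intro h0
  have h1 := congrFun h0 0
  have h2 : ¬ Agree k (0 : Pts p n) (Pi.single j 1) := fun h' => by
    have := h' j hjk
    simp at this
  rw [Pi.sub_apply, ind, ind, if_neg h2, if_pos (Agree.refl _ _)] at h1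
  simp at h1

/-! ### Fibre sums of displacements on $T_j$ -/

theorem mem_weirT_iff {p n m : ℕ} [NeZero p] {g : Equiv.Perm (Pts p n)} :
    g ∈ weirT p n m ↔ g ∈ tri p n ∧ ∀ l : Fin n, (l : ℕ) < m → disp g l = 0 := by
  rw [← sylowP_eq_tri]
  refine and_congr_right fun _ => ⟨fun h l hl => ?_, fun h x l hl => ?_⟩
  · funext x
    simp [disp, h x l hl]
  · exact apply_eq_of_disp_eq_zero (h l hl) x

theorem conj_mem_weirT {p n m : ℕ} [NeZero p] {q g : Equiv.Perm (Pts p n)} (hq : q ∈ tri p n)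
    (hg : g ∈ weirT p n m) : q * g * q⁻¹ ∈ weirT p n m := by
  rw [mem_weirT_iff] at hg ⊢
  refine ⟨mul_mem (mul_mem hq hg.1) (inv_mem hq), fun l hl => ?_⟩
  funext x
  have := (agree_apply_self hg.2 (q⁻¹ x)).mono hl.le
  rw [disp_conj, hq l _ _ this, hg.2 l hl]
  simp

theorem agree_of_mem_weirT {p n m : ℕ} [NeZero p] {g : Equiv.Perm (Pts p n)}
    (hg : g ∈ weirT p n m) (x : Pts p n) : Agree m (g x) x :=
  agree_apply_self (mem_weirT_iff.1 hg).2 x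

/-- The fibre sum of `disp g k` depends on the first `j` coordinates only, and `h` fixes these. -/
theorem fiberSum_disp_mul {p n j : ℕ} [NeZero p] {k : Fin n} (hjk : j ≤ k)
    {g h : Equiv.Perm (Pts p n)} (hg : g ∈ tri p n) (hh : h ∈ weirT p n j) :
    fiberSum j k (disp (g * h) k) = fiberSum j k (disp g k) + fiberSum j k (disp h k) := by
  have e : disp (g * h) k = disp g k ∘ h + disp h k := funext fun x => disp_mul g h k x
  rw [e, map_add, fiberSum_comp hjk (hg k) (mem_weirT_iff.1 hh).1]
  congr 1
  funext x
  exact fiberSum_mem _ _ _ _ _ (agree_of_mem_weirT hh x)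

theorem fiberSum_disp_inv {p n j : ℕ} [NeZero p] {k : Fin n} (hjk : j ≤ k)
    {g : Equiv.Perm (Pts p n)} (hg : g ∈ weirT p n j) :
    fiberSum j k (disp g⁻¹ k) = - fiberSum j k (disp g k) := by
  have := fiberSum_disp_mul hjk (inv_mem (mem_weirT_iff.1 hg).1) hg
  rw [inv_mul_cancel, disp_one, map_zero] at this
  exact eq_neg_of_add_eq_zero_left this.symm

theorem fiberSum_disp_conj {p n j : ℕ} [NeZero p] {k : Fin n} (hjk : j ≤ k)
    {q g : Equiv.Perm (Pts p n)} (hq : q ∈ tri p n) (hg : g ∈ weirT p n j) :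
    fiberSum j k (disp (q * g * q⁻¹) k) = fiberSum j k (disp g k) ∘ ⇑q⁻¹ := by
  have hgt := (mem_weirT_iff.1 hg).1
  have e : disp (q * g * q⁻¹) k = (disp q k ∘ g - disp q k + disp g k) ∘ ⇑q⁻¹ :=
    funext fun x => disp_conj q g k x
  rw [e, fiberSum_comp hjk
    (add_mem (sub_mem (comp_mem_lowFn (hq k) hgt) (hq k)) (hgt k)) (inv_mem hq), map_add, map_sub,
    fiberSum_comp hjk (hq k) hgt]
  have : fiberSum j k (disp q k) ∘ g = fiberSum j k (disp q k) := funext fun x =>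
    fiberSum_mem _ _ _ _ _ (agree_of_mem_weirT hg x)
  rw [this, sub_self, zero_add]

/-! ### Necessity: the exponents of a complemented normal subgroup -/

/-- The elements of a partition subgroup. -/
def IsPartition {p n : ℕ} (j : Fin n) (i : Fin n → ℕ) (N : Subgroup (Equiv.Perm (Pts p n))) :
    Prop :=
  ∀ g, g ∈ N ↔ (∀ k : Fin n, j ≤ k → disp g k ∈ lowerFn p n k (i k)) ∧
    ∀ k : Fin n, k < j → disp g k = 0

section

variable {p n : ℕ} [Fact p.Prime] {j : Fin n} {i : Fin n → ℕ}
  {N C : Subgroup (Equiv.Perm (Pts p n))}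

theorem IsPartition.le_weirT (hN : IsPartition j i N) : N ≤ weirT p n j := fun g hg => by
  obtain ⟨h1, h2⟩ := (hN g).1 hg
  refine mem_weirT_iff.2 ⟨fun k => ?_, fun l hl => h2 l hl⟩
  rcases lt_or_ge k j with hk | hk
  · rw [h2 k hk]; exact zero_mem _
  · exact lowerFn_le _ (h1 k hk)

theorem lowerFn_ne_bot_of_hasDepth (hN : IsPartition j i N) (hd : HasDepth p n N j) :
    lowerFn p n j (i j) ≠ ⊥ := by
  intro h0
  have : (j : ℕ) + 1 ≤ j := hd.2 ⟨j.isLt, fun g hg => by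
    have hgT := mem_weirT_iff.1 (hN.le_weirT hg)
    refine mem_weirT_iff.2 ⟨hgT.1, fun l hl => ?_⟩
    rcases Nat.lt_succ_iff_lt_or_eq.1 hl with hl | hl
    · exact hgT.2 l hl
    · obtain rfl : l = j := Fin.ext hl
      have := ((hN g).1 hg).1 l le_rfl
      rwa [h0, Submodule.mem_bot] at this⟩
  omega

/-- A normal partition subgroup contains the commutators of `A^k` with the translations of
the coordinate `j`. -/
theorem comp_sub_mem_of_normal (hN : IsPartition j i N)
    (hnorm : ∀ q ∈ tri p n, ∀ g ∈ N, q * g * q⁻¹ ∈ N) {k : Fin n} (hjk : j < k)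
    {t : Equiv.Perm (Pts p n)} (ht : t ∈ N) (htk : disp t k = 0)
    {v : Pts p n → ZMod p} (hv : v ∈ lowFn p n k) : v ∘ t - v ∈ lowerFn p n k (i k) := by
  obtain ⟨a, ha, ha1, ha2⟩ := exists_pure hv
  have htt := (mem_weirT_iff.1 (hN.le_weirT ht)).1
  have hai := disp_inv_pure ha ha2
  have hag : ∀ x, Agree k (a⁻¹ x) x := agree_apply_self fun l hl => hai.2 l (Fin.ne_of_lt hl)
  have h1 := ((hN _).1 (hnorm a ha t ht)).1 k hjk.le
  have h2 : disp (a * t * a⁻¹) k = v ∘ t - v := by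
    funext x
    rw [disp_conj, ha1, htk, hv _ _ ((agree_apply_iff htt).2 (hag x)), hv _ _ (hag x)]
    simp
  exact h2 ▸ h1

/-- The nonzero space at `j` contains `1`, so `N` contains the translations `t` of coordinate `j` by
constants. Commutators with shifts of coordinate `k` give `ind k x - ind k (t x)`; moving `t x` to
`y` while fixing `x` gives the claim when `x j ≠ y j`. Otherwise a third point is interposed. -/
theorem ind_sub_ind_mem_of_normal (hN : IsPartition j i N)
    (hnorm : ∀ q ∈ tri p n, ∀ g ∈ N, q * g * q⁻¹ ∈ N) (h0 : lowerFn p n j (i j) ≠ ⊥)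
    {k : Fin n} (hjk : j < k) {x y : Pts p n} (hxy : Agree j x y) :
    ind k y - ind k x ∈ lowerFn p n k (i k) := by
  have h1 : (1 : Pts p n → ZMod p) ∈ lowerFn p n j (i j) :=
    one_mem_of_invariant (fun v hv g hg => comp_mem_lowerFn hv hg) h0
  have key : ∀ x y : Pts p n, Agree j x y → x j ≠ y j →
      ind k y - ind k x ∈ lowerFn p n k (i k) := by
    intro x y hxy hne
    have hc := Submodule.smul_mem _ (y j - x j) h1
    obtain ⟨t, ht, ht1, ht2⟩ := exists_pure (lowerFn_le _ hc)
    have htN : t ∈ N := (hN t).2 ⟨fun l hl => by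
      by_cases hlj : l = j
      · subst hlj; rw [ht1]; exact hc
      · rw [ht2 l hlj]; exact zero_mem _, fun l hl => ht2 l hl.ne⟩
    -- `h` acts only where coordinate `j` equals `y j`, so it fixes `x` and corrects the later
    -- coordinates of `t x`.
    obtain ⟨h, hh, hd⟩ := exists_disp (p := p) (n := n) (fun (l : Fin n) (w : Pts p n) =>
        if j < l ∧ w j = y j then y l - x l else 0) (fun l w w' hw => by
      by_cases hl : j < l
      · simp [hw j hl]
      · simp [hl])
    have hx : h x = x := funext fun l => by simp [apply_eq_add_disp h, hd, hne]
    have htj : t x j = y j := by simp [apply_eq_add_disp t, ht1]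
    have hy : h (t x) = y := funext fun l => by
      rw [apply_eq_add_disp h, hd]
      rcases lt_trichotomy l j with hl | hl | hl
      · rw [apply_eq_of_disp_eq_zero (ht2 l hl.ne), hxy l hl]
        simp
      · subst hl; simp [htj]
      · rw [apply_eq_of_disp_eq_zero (ht2 l hl.ne')]
        simp [hl, htj]
    have h2 := comp_sub_mem_of_normal hN hnorm hjk htN (ht2 k hjk.ne') (ind_mem k (t x))
    rw [ind_comp (mem_weirT_iff.1 (hN.le_weirT htN)).1] at h2
    have h3 := comp_mem_lowerFn h2 (inv_mem hh)
    have e : ∀ z, ind k z ∘ ⇑h⁻¹ = ind k (h z) := fun z => by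
      have := ind_comp (m := k) (inv_mem hh) (h z)
      rwa [show h⁻¹ (h z) = z from Equiv.symm_apply_apply h z] at this
    have h4 : (ind k x - ind k (t x)) ∘ ⇑h⁻¹ = ind k x - ind k y := by
      change ind k x ∘ ⇑h⁻¹ - ind k (t x) ∘ ⇑h⁻¹ = _
      rw [e, e, hx, hy]
    rw [h4] at h3
    rw [← neg_sub]
    exact neg_mem h3
  by_cases hne : x j = y j
  · have hz : Agree j x (Function.update x j (x j + 1)) := fun l hl => by
      rw [Function.update_of_ne (Fin.ne_of_lt hl)]
    have h2 := key x _ hz (by simp)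
    have h3 := key _ y (hz.symm.trans hxy) (by simp [hne])
    have := add_mem h3 h2
    simpa using this
  · exact key x y hxy hne

theorem mem_lowerFn_of_fiberSum_eq_zero (hN : IsPartition j i N)
    (hnorm : ∀ q ∈ tri p n, ∀ g ∈ N, q * g * q⁻¹ ∈ N) (h0 : lowerFn p n j (i j) ≠ ⊥)
    {k : Fin n} (hjk : j ≤ k) {v : Pts p n → ZMod p} (hv : v ∈ lowFn p n k)
    (hv0 : fiberSum j k v = 0) : v ∈ lowerFn p n k (i k) := by
  rcases hjk.lt_or_eq with hlt | rfl
  · exact mem_of_fiberSum_eq_zero (j := j) hjk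
      (fun x y hxy => ind_sub_ind_mem_of_normal hN hnorm h0 hlt hxy) hv hv0
  · have := (mem_lowerFn_pow_iff le_rfl).2 ⟨hv, hv0⟩
    rw [lowerFn_pow_eq_bot, Submodule.mem_bot] at this
    rw [this]; exact zero_mem _

theorem mem_of_fiberSum_mem (hN : IsPartition j i N)
    (hnorm : ∀ q ∈ tri p n, ∀ g ∈ N, q * g * q⁻¹ ∈ N) (h0 : lowerFn p n j (i j) ≠ ⊥)
    {g : Equiv.Perm (Pts p n)} (hg : g ∈ weirT p n j)
    (h : ∀ k : Fin n, j ≤ k →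
      fiberSum j k (disp g k) ∈ (lowerFn p n k (i k)).map (fiberSum j k)) : g ∈ N := by
  obtain ⟨hgt, hg0⟩ := mem_weirT_iff.1 hg
  refine (hN g).2 ⟨fun k hk => ?_, fun k hk => hg0 k hk⟩
  obtain ⟨u, hu, hue⟩ := h k hk
  have : disp g k - u ∈ lowerFn p n k (i k) :=
    mem_lowerFn_of_fiberSum_eq_zero hN hnorm h0 hk (sub_mem (hgt k) (lowerFn_le _ hu))
      (by rw [map_sub, hue, sub_self])
  simpa using add_mem this hu

/-- For a complement `C` of `N`, the vectors of `lowFn p n j` which the elements of `C ⊓ T_j`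
induce on the coordinate `k` alone, modulo `N`. -/
def complementFn (i : Fin n → ℕ) (j : Fin n) (C : Subgroup (Equiv.Perm (Pts p n))) (k : Fin n)
    (hjk : j ≤ k) : AddSubgroup (Pts p n → ZMod p) where
  carrier := {w | ∃ c ∈ C, c ∈ weirT p n j ∧ fiberSum j k (disp c k) = w ∧
    ∀ l : Fin n, j ≤ l → l ≠ k →
      fiberSum j l (disp c l) ∈ (lowerFn p n l (i l)).map (fiberSum j l)}
  zero_mem' := ⟨1, one_mem _, one_mem _, by simp, fun l _ _ => by simp⟩
  add_mem' := by
    rintro _ _ ⟨c, hc, hcT, rfl, hcl⟩ ⟨d, hd, hdT, rfl, hdl⟩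
    refine ⟨c * d, mul_mem hc hd, mul_mem hcT hdT,
      fiberSum_disp_mul hjk (mem_weirT_iff.1 hcT).1 hdT, fun l hl hlk => ?_⟩
    rw [fiberSum_disp_mul hl (mem_weirT_iff.1 hcT).1 hdT]
    exact add_mem (hcl l hl hlk) (hdl l hl hlk)
  neg_mem' := by
    rintro _ ⟨c, hc, hcT, rfl, hcl⟩
    refine ⟨c⁻¹, inv_mem hc, inv_mem hcT, fiberSum_disp_inv hjk hcT, fun l hl hlk => ?_⟩
    rw [fiberSum_disp_inv hl hcT]
    exact neg_mem (hcl l hl hlk)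

theorem comp_mem_map_fiberSum {k : Fin n} (hjk : j ≤ k) {m : ℕ} {w : Pts p n → ZMod p}
    (hw : w ∈ (lowerFn p n k m).map (fiberSum j k)) {g : Equiv.Perm (Pts p n)}
    (hg : g ∈ tri p n) : w ∘ g ∈ (lowerFn p n k m).map (fiberSum j k) := by
  obtain ⟨u, hu, rfl⟩ := hw
  exact ⟨u ∘ g, comp_mem_lowerFn hu hg, fiberSum_comp hjk (lowerFn_le _ hu) hg⟩

/-- Write `g⁻¹ = a * b` with `a` in `N` and `b` in `C`. As `a` fixes the first `j` coordinates,
`b⁻¹` and `g` act alike on fibre sums, and conjugation by `b` stays in `C`. -/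
theorem comp_mem_complementFn (hN : IsPartition j i N) (hC : IsComplementIn (tri p n) N C)
    {k : Fin n} (hjk : j ≤ k) {w : Pts p n → ZMod p} (hw : w ∈ complementFn i j C k hjk)
    {g : Equiv.Perm (Pts p n)} (hg : g ∈ tri p n) : w ∘ g ∈ complementFn i j C k hjk := by
  obtain ⟨c, hc, hcT, rfl, hcl⟩ := hw
  have hgi : g⁻¹ ∈ (N : Set (Equiv.Perm (Pts p n))) * (C : Set (Equiv.Perm (Pts p n))) := by
    rw [hC.2.2]; exact inv_mem hg
  obtain ⟨a, ha, b, hb, hab⟩ := Set.mem_mul.1 hgi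
  have hbt := hC.1 hb
  have hba : b⁻¹ * a⁻¹ = g := by rw [← mul_inv_rev, hab, inv_inv]
  have hag : ∀ x, Agree j (b⁻¹ x) (g x) := fun x => by
    rw [← hba, Equiv.Perm.mul_apply, agree_apply_iff (inv_mem hbt)]
    exact (agree_of_mem_weirT (inv_mem (hN.le_weirT ha)) x).symm
  have hconj : ∀ l : Fin n, j ≤ l →
      fiberSum j l (disp (b * c * b⁻¹) l) = fiberSum j l (disp c l) ∘ g := fun l hl => by
    rw [fiberSum_disp_conj (j := j) hl hbt hcT]
    funext x
    exact fiberSum_mem _ _ _ _ _ (hag x)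
  refine ⟨b * c * b⁻¹, mul_mem (mul_mem hb hc) (inv_mem hb), conj_mem_weirT hbt hcT,
    hconj k hjk, fun l hl hlk => ?_⟩
  rw [hconj l hl]
  exact comp_mem_map_fiberSum hl (hcl l hl hlk) hg

theorem eq_zero_or_map_fiberSum_eq_bot (hN : IsPartition j i N)
    (hnorm : ∀ q ∈ tri p n, ∀ g ∈ N, q * g * q⁻¹ ∈ N) (h0 : lowerFn p n j (i j) ≠ ⊥)
    (hC : IsComplementIn (tri p n) N C) {k : Fin n} (hjk : j ≤ k) :
    i k = 0 ∨ (lowerFn p n k (i k)).map (fiberSum j k) = ⊥ := by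
  by_contra! hcon
  obtain ⟨hik, hbot⟩ := hcon
  have h1 : (1 : Pts p n → ZMod p) ∈ (lowerFn p n k (i k)).map (fiberSum j k) :=
    one_mem_of_invariant (fun v hv g hg => comp_mem_map_fiberSum hjk hv hg) hbot
  have hdisj : ∀ w ∈ complementFn i j C k hjk,
      w ∈ (lowerFn p n k (i k)).map (fiberSum j k) → w = 0 := by
    rintro _ ⟨c, hc, hcT, rfl, hcl⟩ hw
    have hcN : c ∈ N := mem_of_fiberSum_mem hN hnorm h0 hcT fun l hl => by
      by_cases hlk : l = k
      · subst hlk; exact hw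
      · exact hcl l hl hlk
    have : c ∈ N ⊓ C := ⟨hcN, hc⟩
    rw [hC.2.1, Subgroup.mem_bot] at this
    rw [this, disp_one, map_zero]
  -- Two nonzero invariant spaces would share the constant `1`, against `hdisj`.
  have hK : AddSubgroup.toZModSubmodule p (complementFn i j C k hjk) = ⊥ := by
    by_contra hne
    have h2 : (1 : Pts p n → ZMod p) ∈
        AddSubgroup.toZModSubmodule p (complementFn i j C k hjk) :=
      one_mem_of_invariant (fun v hv g hg => comp_mem_complementFn hN hC hjk hv hg) hne
    have := congrFun (hdisj 1 h2 h1) 0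
    simp at this
  -- Split the shift by `u` as `b * c` along `N` and `C`. The fibre sum of `c` at `k` lies in the
  -- zero space `complementFn`, so `u` and `disp b k` have the same fibre sum.
  have hall : ∀ u ∈ lowFn p n k, u ∈ lowerFn p n k (i k) := by
    intro u hu
    obtain ⟨a, ha, ha1, ha2⟩ := exists_pure hu
    have ha' : a ∈ (N : Set (Equiv.Perm (Pts p n))) * (C : Set (Equiv.Perm (Pts p n))) := by
      rw [hC.2.2]; exact ha
    obtain ⟨b, hb, c, hc, rfl⟩ := Set.mem_mul.1 ha'
    have haT : b * c ∈ weirT p n j := mem_weirT_iff.2 ⟨ha, fun l hl => ha2 l (by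
      rintro rfl; exact absurd hl (not_lt.2 hjk))⟩
    have hbT := hN.le_weirT hb
    have hcT : c ∈ weirT p n j := by
      have := mul_mem (inv_mem hbT) haT
      rwa [inv_mul_cancel_left] at this
    have hbt := (mem_weirT_iff.1 hbT).1
    have hcK : fiberSum j k (disp c k) ∈ complementFn i j C k hjk := by
      refine ⟨c, hc, hcT, rfl, fun l hl hlk => ?_⟩
      have h3 := fiberSum_disp_mul (j := j) hl hbt hcT
      rw [ha2 l hlk, map_zero] at h3
      rw [eq_neg_of_add_eq_zero_right h3.symm]
      exact neg_mem ⟨_, ((hN b).1 hb).1 l hl, rfl⟩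
    have hc0 : fiberSum j k (disp c k) = 0 := by
      have : fiberSum j k (disp c k) ∈
        AddSubgroup.toZModSubmodule p (complementFn i j C k hjk) := hcK
      rwa [hK, Submodule.mem_bot] at this
    have h3 := fiberSum_disp_mul (j := j) hjk hbt hcT
    rw [ha1, hc0, add_zero] at h3
    have h4 : u - disp b k ∈ lowerFn p n k (i k) :=
      mem_lowerFn_of_fiberSum_eq_zero hN hnorm h0 hjk (sub_mem hu (hbt k))
        (by rw [map_sub, h3, sub_self])
    simpa using add_mem h4 (((hN b).1 hb).1 k hjk)
  have h3 : lowerFn p n k 0 = lowerFn p n k (i k) :=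
    le_antisymm hall (lowerFn_antitone (Nat.zero_le _))
  refine hik (lowerFn_injective_of_ne_bot h3 ?_).symm
  refine (Submodule.ne_bot_iff _).2 ⟨1, fun _ _ _ => rfl, one_ne_zero⟩

theorem exponents_of_isComplementIn (hN : IsPartition j i N)
    (hnorm : ∀ q ∈ tri p n, ∀ g ∈ N, q * g * q⁻¹ ∈ N) (h0 : lowerFn p n j (i j) ≠ ⊥)
    (hC : IsComplementIn (tri p n) N C) :
    i j = 0 ∧ ∀ k : Fin n, j ≤ k → (i k = 0 ∨ i k = p ^ (j : ℕ)) := by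
  have key : ∀ k : Fin n, j ≤ k → i k = 0 ∨ lowerFn p n k (i k) = lowerFn p n k (p ^ (j : ℕ)) := by
    intro k hjk
    refine (eq_zero_or_map_fiberSum_eq_bot hN hnorm h0 hC hjk).imp_right fun h => ?_
    ext v
    rw [mem_lowerFn_pow_iff hjk]
    constructor
    · intro hv
      refine ⟨lowerFn_le _ hv, ?_⟩
      have : fiberSum j k v ∈ (lowerFn p n k (i k)).map (fiberSum j k) := ⟨v, hv, rfl⟩
      rwa [h, Submodule.mem_bot] at this
    · exact fun hv => mem_lowerFn_of_fiberSum_eq_zero hN hnorm h0 hjk hv.1 hv.2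
  have hj : i j = 0 := (key j le_rfl).resolve_right fun h => h0 (by rw [h, lowerFn_pow_eq_bot])
  refine ⟨hj, fun k hjk => ?_⟩
  rcases hjk.lt_or_eq with hlt | rfl
  · exact (key k hjk).imp_right fun h =>
      (lowerFn_injective_of_ne_bot h.symm (lowerFn_pow_ne_bot hlt)).symm
  · exact Or.inl hj

end

/-! ### Sufficiency: an $H$-invariant complement -/

/-- The first non-zero coordinate of `x` from `j` on is the coordinate `k - 1`. -/
def LeadAt {p n : ℕ} (j k : Fin n) (x : Pts p n) : Prop :=
  ∃ l : Fin n, (l : ℕ) + 1 = k ∧ j ≤ l ∧ x l ≠ 0 ∧ ∀ l' : Fin n, j ≤ l' → l' < l → x l' = 0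

open Classical in
/-- The indicator function of `LeadAt`. -/
noncomputable def lead {p n : ℕ} (j k : Fin n) (x : Pts p n) : ZMod p :=
  if LeadAt j k x then 1 else 0

theorem lead_congr {p n : ℕ} {j k : Fin n} {x y : Pts p n} (h : LeadAt j k x ↔ LeadAt j k y) :
    lead j k x = lead j k y := by
  by_cases h' : LeadAt j k y
  · rw [lead, lead, if_pos h', if_pos (h.2 h')]
  · rw [lead, lead, if_neg h', if_neg (mt h.1 h')]

theorem lead_mem {p n : ℕ} (j k : Fin n) : (lead j k : Pts p n → ZMod p) ∈ lowFn p n k := by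
  intro x y h
  refine lead_congr (exists_congr fun l => and_congr_right fun hl => and_congr_right fun _ => ?_)
  have h1 : ∀ l' : Fin n, l' ≤ l → x l' = y l' := fun l' hl' => h l' (by
    have : (l' : ℕ) ≤ l := hl'
    omega)
  rw [h1 l le_rfl]
  refine and_congr_right fun _ => forall_congr' fun l' => imp_congr_right fun _ =>
    imp_congr_right fun hl' => ?_
  rw [h1 l' hl'.le]

/-- From `j` on, `g` can move only the coordinate right after the first nonzero one, so the leading
position is unchanged. -/
theorem lead_apply {p n : ℕ} {j : Fin n} {g : Equiv.Perm (Pts p n)}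
    (hg : ∀ k : Fin n, j ≤ k → ∃ w : Pts p n → ZMod p, disp g k = w * lead j k)
    (k : Fin n) (x : Pts p n) : lead j k (g x) = lead j k x := by
  have hfix : ∀ m : Fin n, j ≤ m → (∀ l : Fin n, j ≤ l → l < m → x l = 0) → g x m = x m := by
    intro m hm h
    obtain ⟨w, hw⟩ := hg m hm
    have : ¬ LeadAt j m x := by
      rintro ⟨l, hl, hjl, hne, -⟩
      exact hne (h l hjl (Fin.lt_def.2 (by omega)))
    rw [apply_eq_add_disp, hw, Pi.mul_apply, lead, if_neg this, mul_zero, add_zero]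
  have hback : ∀ m : Fin n, (∀ l : Fin n, j ≤ l → l < m → g x l = 0) →
      ∀ l : Fin n, j ≤ l → l < m → x l = 0 := by
    intro m h l
    induction l using WellFoundedLT.induction with
    | _ l ih =>
      intro hjl hlm
      rw [← hfix l hjl fun l' hl' hll' => ih l' hll' hl' (hll'.trans hlm)]
      exact h l hjl hlm
  refine lead_congr (exists_congr fun l => and_congr_right fun _ => and_congr_right fun hjl => ?_)
  constructor
  · rintro ⟨h1, h2⟩
    have h3 := hback l h2
    exact ⟨by rwa [hfix l hjl h3] at h1, h3⟩
  · rintro ⟨h1, h2⟩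
    refine ⟨by rwa [hfix l hjl h2], fun l' hl' hll' => ?_⟩
    rw [hfix l' hl' fun m hm hml => h2 m hm (hml.trans hll'), h2 l' hl' hll']

/-- The triangular permutations which shift a coordinate `k ≥ j` by a multiple of `lead j k` with
a factor depending on the first `j` coordinates, which is zero for `k ∉ S`. -/
def leadGroup (p n : ℕ) (j : Fin n) (S : Set (Fin n)) : Subgroup (Equiv.Perm (Pts p n)) where
  carrier := {g | g ∈ tri p n ∧ ∀ k : Fin n, j ≤ k →
    ∃ w ∈ lowFn p n j, (k ∉ S → w = 0) ∧ disp g k = w * lead j k}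
  one_mem' := ⟨one_mem _, fun k _ => ⟨0, zero_mem _, fun _ => rfl, by simp⟩⟩
  mul_mem' := by
    rintro g h ⟨hg, hg'⟩ ⟨hh, hh'⟩
    refine ⟨mul_mem hg hh, fun k hk => ?_⟩
    obtain ⟨w, hw, hwS, hwd⟩ := hg' k hk
    obtain ⟨u, hu, huS, hud⟩ := hh' k hk
    refine ⟨w ∘ h + u, add_mem (comp_mem_lowFn hw hh) hu, fun hkS => ?_, ?_⟩
    · rw [hwS hkS, huS hkS]; ext; simp
    · funext x
      have := lead_apply (fun k hk => (hh' k hk).imp fun w hw => hw.2.2) k x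
      rw [disp_mul, hwd, hud, Pi.mul_apply, this]
      simp [add_mul]
  inv_mem' := by
    rintro g ⟨hg, hg'⟩
    refine ⟨inv_mem hg, fun k hk => ?_⟩
    obtain ⟨w, hw, hwS, hwd⟩ := hg' k hk
    refine ⟨-(w ∘ ⇑g⁻¹), neg_mem (comp_mem_lowFn hw (inv_mem hg)), fun hkS => ?_, ?_⟩
    · rw [hwS hkS]; ext; simp
    · funext x
      have := lead_apply (fun k hk => (hg' k hk).imp fun w hw => hw.2.2) k (g⁻¹ x)
      rw [show g (g⁻¹ x) = x from Equiv.apply_symm_apply g x] at this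
      rw [disp_inv, hwd, Pi.mul_apply, ← this]
      simp

theorem fiberSum_mul {p n : ℕ} [NeZero p] {j k : ℕ} {w : Pts p n → ZMod p}
    (hw : w ∈ lowFn p n j) (v : Pts p n → ZMod p) :
    fiberSum j k (w * v) = w * fiberSum j k v := by
  classical
  funext x
  rw [Pi.mul_apply, fiberSum_apply, fiberSum_apply, Finset.mul_sum]
  refine Finset.sum_congr rfl fun y _ => ?_
  split_ifs with h
  · rw [Pi.mul_apply, hw _ _ h.1]
  · rw [mul_zero]

/-- In each fibre, exactly the `p - 1` representatives with coordinate `k - 1` nonzero and the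
coordinates from `j` to `k - 2` zero contribute. -/
theorem fiberSum_lead {p n : ℕ} [Fact p.Prime] {j k : Fin n} (hjk : j < k) :
    fiberSum j k (lead j k : Pts p n → ZMod p) = -1 := by
  classical
  funext x
  have hjk' : (j : ℕ) < k := hjk
  let m : Fin n := ⟨k - 1, by omega⟩
  have hmk : (m : ℕ) + 1 = k := by simp only [m]; omega
  have hjm : j ≤ m := Fin.le_def.2 (by omega)
  have hsum : ∑ t : ZMod p, (if t = 0 then (0 : ZMod p) else 1) = -1 := by
    have : ∀ t : ZMod p, (if t = 0 then (0 : ZMod p) else 1) = 1 - if t = 0 then 1 else 0 :=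
      fun t => by split_ifs <;> simp
    rw [Finset.sum_congr rfl fun t _ => this t, Finset.sum_sub_distrib]
    simp
  rw [fiberSum_apply, Pi.neg_apply, Pi.one_apply, ← hsum]
  symm
  have hres : ∀ t : ZMod p, Agree j (Function.update (res j x) m t) x := fun t l hl => by
    rw [Function.update_of_ne (by rintro rfl; exact absurd hl (not_lt.2 hjm)), agree_res _ _ l hl]
  have hzero : ∀ (t : ZMod p) (l : Fin n), j ≤ l → l ≠ m →
      Function.update (res j x) m t l = 0 := fun t l hl hlm => by
    rw [Function.update_of_ne hlm]
    exact if_neg (not_lt.2 hl)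
  refine Finset.sum_of_injOn (fun t => Function.update (res (j : ℕ) x) m t)
    (Function.update_injective (res (j : ℕ) x) m).injOn (fun _ _ => Finset.mem_coe.2 (Finset.mem_univ _)) ?_ ?_
  · intro y _ hy
    split_ifs with h
    swap
    · rfl
    rw [lead, if_neg]
    rintro ⟨l, hl, hjl, hne, h0⟩
    obtain rfl : l = m := Fin.ext (by omega)
    refine hy ⟨y m, Finset.mem_coe.2 (Finset.mem_univ _), funext fun l' => ?_⟩
    by_cases hl' : l' = m
    · subst hl'; simp
    rcases lt_or_ge l' j with hlj | hlj
    · exact (hres _ l' hlj).trans (h.1 l' hlj).symm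
    · refine (hzero _ _ hlj hl').trans ?_
      rcases lt_or_gt_of_ne hl' with h1 | h1
      · exact (h0 l' hlj h1).symm
      · exact (res_eq_self_iff.1 h.2 l' (by have : (m : ℕ) < l' := h1; omega)).symm
  · intro t _
    have hcond : Agree j (Function.update (res (j : ℕ) x) m t) x ∧
        res (k : ℕ) (Function.update (res (j : ℕ) x) m t) = Function.update (res (j : ℕ) x) m t :=
      ⟨hres t, res_eq_self_iff.2 fun l hl => hzero t l (hjk'.le.trans hl) (by
        rintro rfl; omega)⟩
    rw [if_pos hcond]
    by_cases ht : t = 0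
    · rw [if_pos ht, lead, if_neg]
      rintro ⟨l, hl, hjl, hne, -⟩
      obtain rfl : l = m := Fin.ext (by omega)
      simp [ht] at hne
    · rw [if_neg ht, lead, if_pos]
      exact ⟨m, hmk, hjm, by simpa using ht, fun l' h1 h2 => hzero t l' h1 h2.ne⟩

theorem isComplementIn_leadGroup {p n : ℕ} [Fact p.Prime] {j : Fin n} {i : Fin n → ℕ}
    {N : Subgroup (Equiv.Perm (Pts p n))} (hN : IsPartition j i N) (hj : i j = 0)
    (hi : ∀ k : Fin n, j ≤ k → (i k = 0 ∨ i k = p ^ (j : ℕ))) :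
    IsComplementIn (tri p n) N (leadGroup p n j {k | i k ≠ 0}) := by
  have hik : ∀ k : Fin n, j ≤ k → i k ≠ 0 → j < k ∧ i k = p ^ (j : ℕ) := fun k hk h0 =>
    ⟨lt_of_le_of_ne hk fun h => h0 (h ▸ hj), (hi k hk).resolve_left h0⟩
  refine ⟨fun g hg => hg.1, ?_, ?_⟩
  · refine (Subgroup.eq_bot_iff_forall _).2 ?_
    rintro g ⟨hgN, hgC⟩
    obtain ⟨h1, h2⟩ := (hN g).1 hgN
    refine ext_disp fun k => ?_
    rw [disp_one]
    rcases lt_or_ge k j with hk | hk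
    · exact h2 k hk
    obtain ⟨w, hw, hwS, hwd⟩ := hgC.2 k hk
    suffices w = 0 by rw [hwd, this, zero_mul]
    by_cases h0 : i k = 0
    · exact hwS fun h => h h0
    · obtain ⟨hjk, hpk⟩ := hik k hk h0
      have h3 := h1 k hk
      rw [hpk, mem_lowerFn_pow_iff hk, hwd, fiberSum_mul hw, fiberSum_lead hjk] at h3
      simpa using h3.2
  · refine Set.Subset.antisymm ?_ fun g hg => ?_
    · rintro _ ⟨a, ha, c, hc, rfl⟩
      exact mul_mem (mem_weirT_iff.1 (hN.le_weirT ha)).1 hc.1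
    classical
    -- Since `lead j k` has fibre sum `-1`, the minus sign gives `c` the same fibre sum as `g`
    -- wherever `i k ≠ 0`.
    obtain ⟨c, hc, hcd⟩ := exists_disp (p := p) (fun k : Fin n => if k < j then disp g k else
      if i k = 0 then 0 else -fiberSum j k (disp g k) * lead j k) (fun k => by
      split_ifs with h1 h2
      · exact hg k
      · exact zero_mem _
      · intro x y hxy
        rw [Pi.mul_apply, Pi.mul_apply, Pi.neg_apply, Pi.neg_apply, lead_mem j k x y hxy,
          fiberSum_mem j k _ x y (hxy.mono (not_lt.1 h1))])
    have hcC : c ∈ leadGroup p n j {k | i k ≠ 0} := by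
      refine ⟨hc, fun k hk => ?_⟩
      by_cases h0 : i k = 0
      · exact ⟨0, zero_mem _, fun _ => rfl, by rw [hcd]; simp [not_lt.2 hk, h0]⟩
      · exact ⟨-fiberSum j k (disp g k), neg_mem (fiberSum_mem j k _), fun h => absurd h0 h,
          by rw [hcd]; simp [not_lt.2 hk, h0]⟩
    have hat : g * c⁻¹ ∈ tri p n := mul_mem hg (inv_mem hc)
    have hda : ∀ k, disp (g * c⁻¹) k ∘ c + disp c k = disp g k := fun k => by
      funext x
      have := disp_mul (g * c⁻¹) c k x
      rw [inv_mul_cancel_right] at this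
      exact this.symm
    have hcomp : ∀ v : Pts p n → ZMod p, v ∘ c = 0 → v = 0 := fun v hv => funext fun x => by
      simpa using congrFun hv (c⁻¹ x)
    refine Set.mem_mul.2 ⟨g * c⁻¹, (hN _).2 ⟨fun k hk => ?_, fun k hk => ?_⟩, c, hcC, by simp⟩
    · by_cases h0 : i k = 0
      · rw [h0]; exact hat k
      obtain ⟨hjk, hpk⟩ := hik k hk h0
      rw [hpk, mem_lowerFn_pow_iff hk]
      refine ⟨hat k, hcomp _ ?_⟩
      -- The fibre sums of `g` and `c` cancel, which leaves that of `g * c⁻¹` equal to zero.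
      have h3 := congrArg (fiberSum (j : ℕ) k) (hda k)
      rw [map_add, fiberSum_comp hk (hat k) hc, hcd, if_neg (not_lt.2 hk), if_neg h0,
        fiberSum_mul (neg_mem (fiberSum_mem _ _ _)), fiberSum_lead hjk] at h3
      simpa using h3
    · refine hcomp _ ?_
      have := hda k
      rw [hcd, if_pos hk] at this
      simpa using this

theorem eta_apply {p n : ℕ} (r : (ZMod p)ˣ) (m l : Fin n) (x : Pts p n) :
    eta p n r m x l = (if l = m then (r : ZMod p) else 1) * x l := by
  by_cases h : l = m
  · subst h; simp [eta]
  · simp [eta, h]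

theorem eta_inv {p n : ℕ} (r : (ZMod p)ˣ) (m : Fin n) :
    (eta p n r m)⁻¹ = eta p n r⁻¹ m := Equiv.ext fun _ => rfl

/-- Rescaling a coordinate by a unit preserves which coordinates vanish, hence `lead`; only the
factor `w` is transformed. -/
theorem conj_eta_mem_leadGroup {p n : ℕ} {j : Fin n} {S : Set (Fin n)} (r : (ZMod p)ˣ)
    (m : Fin n) {g : Equiv.Perm (Pts p n)} (hg : g ∈ leadGroup p n j S) :
    eta p n r m * g * (eta p n r m)⁻¹ ∈ leadGroup p n j S := by
  have hlow : ∀ {t : ℕ} {v : Pts p n → ZMod p}, v ∈ lowFn p n t →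
      v ∘ eta p n r⁻¹ m ∈ lowFn p n t := fun hv x y h => hv _ _ fun l hl => by
    rw [eta_apply, eta_apply, h l hl]
  have hd : ∀ k, disp (eta p n r m * g * (eta p n r m)⁻¹) k =
      (if k = m then (r : ZMod p) else 1) • (disp g k ∘ eta p n r⁻¹ m) := fun k => by
    funext x
    have hx : eta p n r m (eta p n r⁻¹ m x) = x := by
      rw [← eta_inv]; exact Equiv.apply_symm_apply _ x
    have hxk := congrFun hx k
    rw [eta_apply] at hxk
    rw [Pi.smul_apply, Function.comp_apply, disp, disp, eta_inv, Equiv.Perm.mul_apply,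
      Equiv.Perm.mul_apply, eta_apply, smul_eq_mul, mul_sub, hxk]
  have hlead : ∀ (k : Fin n) (x : Pts p n), lead j k (eta p n r⁻¹ m x) = lead j k x :=
    fun k x => by
    have h0 : ∀ l, eta p n r⁻¹ m x l = 0 ↔ x l = 0 := fun l => by
      rw [eta_apply]
      split_ifs
      · exact Units.mul_right_eq_zero _
      · rw [one_mul]
    exact lead_congr (by simp only [LeadAt, ne_eq, h0])
  refine ⟨fun k => hd k ▸ Submodule.smul_mem _ _ (hlow (hg.1 k)), fun k hk => ?_⟩
  obtain ⟨w, hw, hwS, hwd⟩ := hg.2 k hk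
  refine ⟨(if k = m then (r : ZMod p) else 1) • (w ∘ eta p n r⁻¹ m),
    Submodule.smul_mem _ _ (hlow hw), fun hkS => ?_, ?_⟩
  · rw [hwS hkS]; ext; simp
  · rw [hd, hwd]
    funext x
    rw [Pi.smul_apply, Function.comp_apply, Pi.mul_apply, hlead, Pi.mul_apply, Pi.smul_apply,
      smul_mul_assoc]
    rfl

theorem isConjInvariant_leadGroup {p n : ℕ} (j : Fin n) (S : Set (Fin n)) (r : (ZMod p)ˣ) :
    IsConjInvariant (hallH p n r) (leadGroup p n j S) := by
  have hle : hallH p n r ≤ Subgroup.normalizer (leadGroup p n j S) := by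
    refine (Subgroup.closure_le _).2 ?_
    rintro _ ⟨m, rfl⟩
    refine Subgroup.mem_normalizer_iff.2 fun g => ⟨conj_eta_mem_leadGroup r m, fun h => ?_⟩
    have := conj_eta_mem_leadGroup r⁻¹ m h
    rw [← eta_inv] at this
    simpa [mul_assoc] using this
  intro h hh
  ext g
  have := Subgroup.mem_normalizer_iff''.1 (hle hh) g
  rw [Subgroup.mem_map_equiv, MulAut.conj_symm_apply]
  exact this.symm

end PartitionSubgroups

open PartitionSubgroups in
theorem proposition11p2 (p n : ℕ) (hp : p.Prime)
    (r : (ZMod p)ˣ) (hr : ∀ u : (ZMod p)ˣ, u ∈ Subgroup.zpowers r)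
    (N : Subgroup (Equiv.Perm (PartitionSubgroups.Pts p n)))
    (j : Fin n) (i : Fin n → ℕ)
    (hN : (N : Set (Equiv.Perm (PartitionSubgroups.Pts p n))) =
      PartitionSubgroups.partitionProduct p n j i)
    (hle : N ≤ PartitionSubgroups.sylowP p n)
    (hnormal : (N.subgroupOf (PartitionSubgroups.sylowP p n)).Normal)
    (hdepth : PartitionSubgroups.HasDepth p n N j) :
    List.TFAE [
      ∃ C, PartitionSubgroups.IsComplementIn (PartitionSubgroups.sylowP p n) N C,
      ∃ C, PartitionSubgroups.IsComplementIn (PartitionSubgroups.sylowP p n) N C ∧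
        PartitionSubgroups.IsConjInvariant (PartitionSubgroups.hallH p n r) C,
      i j = 0 ∧ ∀ k : Fin n, j ≤ k → (i k = 0 ∨ i k = p ^ (j : ℕ))] := by
  have : Fact p.Prime := ⟨hp⟩
  have hPart : IsPartition j i N := fun g => by
    rw [← SetLike.mem_coe, hN, mem_partitionProduct_iff]
  rw [sylowP_eq_tri] at hle hnormal ⊢
  have hnorm : ∀ q ∈ tri p n, ∀ g ∈ N, q * g * q⁻¹ ∈ N := fun q hq g hg =>
    hnormal.conj_mem ⟨g, hle hg⟩ hg ⟨q, hq⟩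
  tfae_have 1 → 3 := fun ⟨_, hC⟩ =>
    exponents_of_isComplementIn hPart hnorm (lowerFn_ne_bot_of_hasDepth hPart hdepth) hC
  tfae_have 3 → 2 := fun ⟨hj, hi⟩ =>
    ⟨_, isComplementIn_leadGroup hPart hj hi, isConjInvariant_leadGroup _ _ _⟩
  tfae_have 2 → 1 := fun ⟨C, hC, _⟩ => ⟨C, hC⟩
  tfae_finish
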